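/- Let $(\Pi,\nu)$ be a finite measure space. An adjoint Markov semigroup on $L^1(\nu)$ is a $C_0$-semigroup $\{S_t\}_{t\ge0}$ on $L^1(\nu)$ that is positive ($f\ge 0\Rightarrow S_tf\ge0$) and mass conserving ($\int S_tf\,d\nu=\int f\,d\nu$); its infinitesimal generator is called an adjoint Markov generator. Let $T\in(0,\infty)$, let $(\mathcal K^*,D(\mathcal K^*))$ be an adjoint Markov generator on $L^1(\nu)$ with semigroup $\{e^{t\mathcal K^*}\}_{t\ge0}$, and let $\{\mathcal A_t^*\}_{t\in[0,T]}$, $\{\mathcal B_t^*\}_{t\in[0,T]}$ be families of bounded adjoint Markov generators on $L^1(\nu)$. Assume: 1. $1\in D(\mathcal K^*)$ and $\|\mathcal K^*1\|_{L^\infty(\nu)}<\infty$; 2. $t\mapsto\mathcal A_t^*$ and $t\mapsto\mathcal B_t^*$ are continuous on $[0,T]$ in the operator norm of $L^1(\nu)$ (hence uniformly bounded there); 3. $\mathcal A_t^*$ and $\mathcal B_t^*$ restrict to bounded operators on $L^\infty(\nu)$, with operator norms bounded uniformly in $t\in[0,T]$. Let $\rho,\sigma\in C([0,T];L^1(\nu))$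 be mild solutions of $\partial_t\rho_t=\mathcal K^*\rho_t+\mathcal A_t^*\rho_t$ and $\partial_t\sigma_t=\mathcal K^*\sigma_t+\mathcal B_t^*\sigma_t$, that is, for all $t\in[0,T]$, $$\rho_t=e^{t\mathcal K^*}\rho_0+\int_0^te^{(t-s)\mathcal K^*}\mathcal A_s^*\rho_s\,ds,\qquad \sigma_t=e^{t\mathcal K^*}\sigma_0+\int_0^te^{(t-s)\mathcal K^*}\mathcal B_s^*\sigma_s\,ds,$$ where $\rho_0,\sigma_0$ are probability densities with respect to $\nu$, $\rho_0\log\rho_0\in L^1(\nu)$, and $\sigma_0>0$ $\nu$-a.e. with $\|\log\sigma_0\|_{L^\infty(\nu)}<\infty$. Write $\mathcal H(\rho\|\sigma)=\int_\Pi\rho\log(\rho/\sigma)\,d\nu$ and $d\sigma_s=\sigma_s\,d\nu$. Then for every $s\in[0,T]$, $\rho_s$ and $\sigma_s$ are probability densities, $\sigma_s>0$ $\nu$-a.e., and $\rho_s\log(\rho_s/\sigma_s)\in L^1(\nu)$; and for all $t\in[0,T]$ and $\eta>0$, all integrals below are well defined and finite and $$\mathcal H(\rho_t\|\sigma_t)\le\mathcal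 H(\rho_0\|\sigma_0)+\eta\int_0^t\left[\mathcal H(\rho_s\|\sigma_s)+\log\int_\Pi\exp\left(\frac1\eta\,\frac{(\mathcal A_s^*-\mathcal B_s^*)\sigma_s}{\sigma_s}\right)d\sigma_s\right]ds.$$ -/

import Mathlib

open MeasureTheory Filter Topology Set
open scoped ENNReal

noncomputable section

/-- A `C₀`-semigroup `{S_t}_{t ≥ 0}` of bounded operators on a real normed space.
Only the values `S t` with `t ≥ 0` are meaningful. -/
structure IsC0Semigroup {X : Type*} [NormedAddCommGroup X] [NormedSpace ℝ X]
    (S : ℝ → X →L[ℝ] X) : Prop where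
  zero : S 0 = ContinuousLinearMap.id ℝ X
  add : ∀ s t : ℝ, 0 ≤ s → 0 ≤ t → S (s + t) = (S s).comp (S t)
  tendsto : ∀ x : X, Tendsto (fun h : ℝ => S h x) (𝓝[>] 0) (𝓝 x)

/-- The domain of the infinitesimal generator: all `x` for which `(S_h x - x) / h` has a limit
in norm as `h ↘ 0`. -/
def generatorDomain {X : Type*} [NormedAddCommGroup X] [NormedSpace ℝ X]
    (S : ℝ → X →L[ℝ] X) : Submodule ℝ X where
  carrier := {x | ∃ y : X, Tendsto (fun h : ℝ => h⁻¹ • (S h x - x)) (𝓝[>] 0) (𝓝 y)}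
  zero_mem' := ⟨0, by simp⟩
  add_mem' := by
    rintro a b ⟨y, hy⟩ ⟨z, hz⟩
    refine ⟨y + z, (hy.add hz).congr fun h => ?_⟩
    rw [map_add, ← smul_add]
    congr 1
    abel
  smul_mem' := by
    rintro c a ⟨y, hy⟩
    refine ⟨c • y, (hy.const_smul c).congr fun h => ?_⟩
    rw [map_smul, ← smul_sub, smul_comm]

/-- The infinitesimal generator `x ↦ lim_{h ↘ 0} (S_h x - x) / h` of a family of operators, as an
(in general unbounded) operator with domain `generatorDomain S`. -/
def infinitesimalGenerator {X : Type*} [NormedAddCommGroup X] [NormedSpace ℝ X]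
    (S : ℝ → X →L[ℝ] X) : X →ₗ.[ℝ] X where
  domain := generatorDomain S
  toFun :=
    { toFun := fun x => x.2.choose
      map_add' := by
        intro a b
        refine tendsto_nhds_unique (a + b).2.choose_spec
          ((a.2.choose_spec.add b.2.choose_spec).congr fun h => ?_)
        rw [Submodule.coe_add, map_add, ← smul_add]
        congr 1
        abel
      map_smul' := by
        intro c a
        refine tendsto_nhds_unique (c • a).2.choose_spec
          ((a.2.choose_spec.const_smul c).congr fun h => ?_)
        rw [Submodule.coe_smul, map_smul, ← smul_sub, smul_comm] }

/-- The generator is the limit of the difference quotients. -/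
theorem infinitesimalGenerator_spec {X : Type*} [NormedAddCommGroup X] [NormedSpace ℝ X]
    (S : ℝ → X →L[ℝ] X) (x : (infinitesimalGenerator S).domain) :
    Tendsto (fun h : ℝ => h⁻¹ • (S h (x : X) - (x : X))) (𝓝[>] 0)
      (𝓝 (infinitesimalGenerator S x)) :=
  x.2.choose_spec

/-- An adjoint Markov semigroup on `L¹(ν)`: a `C₀`-semigroup that is positive and conserves
mass. -/
structure IsAdjointMarkovSemigroup {Ω : Type*} [MeasurableSpace Ω] (ν : Measure Ω)
    (S : ℝ → Lp ℝ 1 ν →L[ℝ] Lp ℝ 1 ν) : Prop extends IsC0Semigroup S where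
  nonneg : ∀ t : ℝ, 0 ≤ t → ∀ f : Lp ℝ 1 ν, 0 ≤ f → 0 ≤ S t f
  mass : ∀ t : ℝ, 0 ≤ t → ∀ f : Lp ℝ 1 ν, ∫ x, S t f x ∂ν = ∫ x, f x ∂ν

/-- An everywhere defined bounded operator on `L¹(ν)` is a bounded adjoint Markov generator if it
is the infinitesimal generator of some adjoint Markov semigroup. -/
def IsBoundedAdjointMarkovGenerator {Ω : Type*} [MeasurableSpace Ω] (ν : Measure Ω)
    (A : Lp ℝ 1 ν →L[ℝ] Lp ℝ 1 ν) : Prop :=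
  ∃ S : ℝ → Lp ℝ 1 ν →L[ℝ] Lp ℝ 1 ν,
    IsAdjointMarkovSemigroup ν S ∧
      infinitesimalGenerator S = (A : Lp ℝ 1 ν →ₗ[ℝ] Lp ℝ 1 ν).toPMap ⊤

/-- The operators `A t`, `t ∈ [0, T]`, map `L^∞(ν)` (a subspace of `L¹(ν)`, the measure being
finite) to `L^∞(ν)`, with operator norms `L^∞ → L^∞` bounded uniformly in `t`. -/
def UniformlyBoundedOnLinfty {Ω : Type*} [MeasurableSpace Ω] (ν : Measure Ω) (T : ℝ)
    (A : ℝ → Lp ℝ 1 ν →L[ℝ] Lp ℝ 1 ν) : Prop :=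
  ∃ C : ℝ, 0 ≤ C ∧ ∀ t ∈ Icc 0 T, ∀ f : Lp ℝ 1 ν, MemLp f ∞ ν →
    eLpNorm (A t f) ∞ ν ≤ ENNReal.ofReal C * eLpNorm f ∞ ν

/-- `ρ ∈ C([0,T]; L¹(ν))` is a mild solution of `∂_t ρ_t = K ρ_t + A_t ρ_t` on `[0, T]`, where `K`
is the generator of the semigroup `S`, that is `S t = e^{tK}`. (The integral is a Bochner
integral in `L¹(ν)`; its integrand is continuous when `t ↦ A t` is.) -/
def IsMildSolution {Ω : Type*} [MeasurableSpace Ω] (ν : Measure Ω)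
    (S : ℝ → Lp ℝ 1 ν →L[ℝ] Lp ℝ 1 ν) (A : ℝ → Lp ℝ 1 ν →L[ℝ] Lp ℝ 1 ν) (T : ℝ)
    (ρ : ℝ → Lp ℝ 1 ν) : Prop :=
  ContinuousOn ρ (Icc 0 T) ∧
    ∀ t ∈ Icc 0 T, ρ t = S t (ρ 0) + ∫ s in (0 : ℝ)..t, S (t - s) (A s (ρ s))

/-- `f ∈ P(Ω) ∩ L¹(ν)`: a probability density with respect to `ν`. -/
def IsProbDensity {Ω : Type*} [MeasurableSpace Ω] (ν : Measure Ω) (f : Lp ℝ 1 ν) : Prop :=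
  0 ≤ f ∧ ∫ x, f x ∂ν = 1

/-- `‖log f‖_{L^∞(ν)} < ∞`, where `f` is positive almost everywhere so that `log f` makes sense. -/
def HasBoundedLog {Ω : Type*} [MeasurableSpace Ω] (ν : Measure Ω) (f : Lp ℝ 1 ν) : Prop :=
  (∀ᵐ x ∂ν, 0 < f x) ∧ MemLp (fun x => Real.log (f x)) ∞ ν

/-- The relative entropy `H(ρ‖σ) = ∫ ρ log(ρ/σ) dν`. (It is only used where `σ > 0` almost
everywhere and the integrand is integrable; `0 log 0 = 0`.) -/
def relEntropy {Ω : Type*} [MeasurableSpace Ω] (ν : Measure Ω) (ρ σ : Lp ℝ 1 ν) : ℝ :=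
  ∫ x, ρ x * Real.log (ρ x / σ x) ∂ν

/-- The function `exp(η⁻¹ (Dσ)/σ) σ`, whose integral against `ν` is
`∫ exp(η⁻¹ (Dσ)/σ) dσ` with `dσ = σ dν`. -/
def expPerturbation {Ω : Type*} [MeasurableSpace Ω] (ν : Measure Ω)
    (D : Lp ℝ 1 ν →L[ℝ] Lp ℝ 1 ν) (η : ℝ) (σ : Lp ℝ 1 ν) (x : Ω) : ℝ :=
  Real.exp (η⁻¹ * ((D σ : Lp ℝ 1 ν) x / σ x)) * σ x

end

/-! ### Contractive semigroups and mild solutions -/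

section Semigroup

variable {X : Type*} [NormedAddCommGroup X] [NormedSpace ℝ X] {S : ℝ → X →L[ℝ] X}

/-! Formally, let both densities evolve by `K + A s`. Relative entropy would then decrease, by data
processing for Markov operators. The second density in fact evolves by `K + B s`, and this
discrepancy costs at most `∫ (ρ/σ) (A s - B s) σ dν`. The Gibbs variational principle bounds this
cost by `η` times the entropy plus `η` times the log-exponential moment.

`K` is unbounded and the solutions are only mild, so the entropy is not differentiated. Near time
`s`, `ρ` is followed to first order by the Markov operators `V h = S h ∘ M h`, where `M` is the
semigroup generated by `A s`. Applied to `σ s`, the same operators differ from `σ` by `h (A s - B s)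
σ s + o(h)` (`IsMildSolution.tendsto_step`).

The errors are only `o(h)` in `L¹`, so the entropy density is replaced by a supremum of linear
functions of `(ρ, σ)` with slopes cut off at level `m`. This density is Lipschitz, and positivity of
`V h` alone gives its data processing inequality (`IsMarkovOp.truncEntropy_le`). Integrating in time
and letting `m → ∞` yields the entropy inequality with drift (`IsEntropyFlow.relEntropy_le`).

The limit needs `σ` bounded below and the drift bounded. Both follow by comparing solutions with
multiples of the constant `1`, which `K` and `A s`, `B s` move at a bounded rate
(`const_le_of_step`). -/

theorem tendsto_sub_nhdsGT_zero (s : ℝ) : Tendsto (fun t : ℝ => t - s) (𝓝[>] s) (𝓝[>] 0) := by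
  refine tendsto_nhdsWithin_iff.2 ⟨?_, ?_⟩
  · have : Tendsto (fun t : ℝ => t - s) (𝓝 s) (𝓝 (s - s)) := (continuous_sub_right s).tendsto s
    rw [sub_self] at this
    exact this.mono_left nhdsWithin_le_nhds
  · filter_upwards [self_mem_nhdsWithin] with t ht
    exact mem_Ioi.2 (sub_pos.2 (mem_Ioi.1 ht))

theorem IsC0Semigroup.norm_sub_le (hS : IsC0Semigroup S)
    (hc : ∀ t, 0 ≤ t → ∀ f, ‖S t f‖ ≤ ‖f‖) {s t : ℝ} (hs : 0 ≤ s) (ht : 0 ≤ t) (f : X) :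
    ‖S t f - S s f‖ ≤ ‖S |t - s| f - f‖ := by
  wlog h : s ≤ t generalizing s t
  · rw [norm_sub_rev, abs_sub_comm]
    exact this ht hs (le_of_not_ge h)
  · have h0 : 0 ≤ t - s := sub_nonneg.2 h
    rw [abs_of_nonneg h0]
    have : S t = (S s).comp (S (t - s)) := by rw [← hS.add s (t - s) hs h0]; congr 1; ring
    rw [this, ContinuousLinearMap.comp_apply, ← map_sub]
    exact hc s hs _

theorem IsC0Semigroup.tendsto_nhdsGE (hS : IsC0Semigroup S) (f : X) :
    Tendsto (fun h => S h f) (𝓝[≥] 0) (𝓝 f) := by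
  rw [← Ioi_insert, nhdsWithin_insert]
  refine Tendsto.sup ?_ (hS.tendsto f)
  have h0 : S 0 f = f := by rw [hS.zero]; rfl
  rw [tendsto_pure_left]
  intro s hs
  simpa [h0] using mem_of_mem_nhds hs

/-- Contractivity makes the operators equicontinuous, so strong continuity upgrades to joint
continuity in time and vector. This makes the Duhamel integrand continuous. -/
theorem IsC0Semigroup.continuousOn (hS : IsC0Semigroup S)
    (hc : ∀ t, 0 ≤ t → ∀ f, ‖S t f‖ ≤ ‖f‖) :
    ContinuousOn (fun p : ℝ × X => S p.1 p.2) (Ici 0 ×ˢ univ) := by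
  rintro ⟨t, f⟩ ⟨ht, -⟩
  rw [ContinuousWithinAt, tendsto_iff_norm_sub_tendsto_zero]
  have h1 : Tendsto (fun p : ℝ × X => ‖p.2 - f‖ + ‖S |p.1 - t| f - f‖)
      (𝓝[Ici 0 ×ˢ univ] (t, f)) (𝓝 (0 + 0)) := by
    refine Tendsto.add ?_ ?_
    · have : Continuous fun p : ℝ × X => ‖p.2 - f‖ := by fun_prop
      simpa using (this.tendsto (t, f)).mono_left nhdsWithin_le_nhds
    · have h2 : Tendsto (fun p : ℝ × X => |p.1 - t|) (𝓝[Ici 0 ×ˢ univ] (t, f)) (𝓝[≥] 0) := by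
        refine tendsto_nhdsWithin_iff.2 ⟨?_, Eventually.of_forall fun p => mem_Ici.2 (abs_nonneg _)⟩
        have : Continuous fun p : ℝ × X => |p.1 - t| := by fun_prop
        simpa using (this.tendsto (t, f)).mono_left nhdsWithin_le_nhds
      exact tendsto_iff_norm_sub_tendsto_zero.1 ((hS.tendsto_nhdsGE f).comp h2)
  rw [add_zero] at h1
  refine squeeze_zero' (Eventually.of_forall fun _ => norm_nonneg _) ?_ h1
  filter_upwards [self_mem_nhdsWithin] with p hp
  calc ‖S p.1 p.2 - S t f‖ = ‖S p.1 (p.2 - f) + (S p.1 f - S t f)‖ := by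
        rw [map_sub]; congr 1; abel
    _ ≤ ‖p.2 - f‖ + ‖S |p.1 - t| f - f‖ :=
        (norm_add_le _ _).trans (add_le_add (hc _ hp.1 _) (hS.norm_sub_le hc ht hp.1 f))

theorem IsC0Semigroup.tendsto_apply (hS : IsC0Semigroup S)
    (hc : ∀ t, 0 ≤ t → ∀ f, ‖S t f‖ ≤ ‖f‖) {α : Type*} {l : Filter α} {τ : α → ℝ} {u : α → X}
    {f : X} (hτ : Tendsto τ l (𝓝[≥] 0)) (hu : Tendsto u l (𝓝 f)) :
    Tendsto (fun x => S (τ x) (u x)) l (𝓝 f) := by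
  have h := hS.continuousOn hc (0, f) ⟨self_mem_Ici, mem_univ _⟩
  have h0 : S 0 f = f := by rw [hS.zero]; rfl
  rw [ContinuousWithinAt, h0] at h
  refine Tendsto.comp (f := fun x => (τ x, u x)) h (tendsto_nhdsWithin_iff.2 ⟨?_, ?_⟩)
  · exact (hτ.mono_right nhdsWithin_le_nhds).prodMk_nhds hu
  · filter_upwards [(tendsto_nhdsWithin_iff.1 hτ).2] with x hx
    exact ⟨hx, mem_univ _⟩

/-- A mild solution `u` of `u' = K u + g` satisfies `u t = S (t - s) (u s) + (t - s) g s + o(t - s)`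
as `t ↘ s`. -/
theorem IsC0Semigroup.tendsto_mild [CompleteSpace X] (hS : IsC0Semigroup S)
    (hc : ∀ t, 0 ≤ t → ∀ f, ‖S t f‖ ≤ ‖f‖) {T : ℝ} {u g : ℝ → X} (hg : ContinuousOn g (Icc 0 T))
    (hu : ∀ t ∈ Icc 0 T, u t = S t (u 0) + ∫ r in (0 : ℝ)..t, S (t - r) (g r))
    {s : ℝ} (hs : s ∈ Ico 0 T) :
    Tendsto (fun t => (t - s)⁻¹ • (u t - S (t - s) (u s))) (𝓝[>] s) (𝓝 (g s)) := by
  have hcont : ∀ t ∈ Icc 0 T, ContinuousOn (fun r => S (t - r) (g r)) (Icc 0 t) := by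
    intro t ht
    refine (hS.continuousOn hc).comp (f := fun r => (t - r, g r)) ?_ ?_
    · exact (by fun_prop : ContinuousOn (fun r => t - r) (Icc 0 t)).prodMk
        (hg.mono (Icc_subset_Icc_right ht.2))
    · intro r hr
      exact ⟨sub_nonneg.2 hr.2, mem_univ _⟩
  -- Duhamel's formula restarted at time `s`: the semigroup law absorbs the part of the integral
  -- over `[0, s]`.
  have hstep : ∀ t ∈ Ioc s T, u t - S (t - s) (u s) = ∫ r in s..t, S (t - r) (g r) := by
    intro t ht
    have ht0 : t ∈ Icc 0 T := ⟨hs.1.trans ht.1.le, ht.2⟩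
    have hs0 : s ∈ Icc 0 T := ⟨hs.1, hs.2.le⟩
    have hi : ∀ a b, a ∈ Icc 0 t → b ∈ Icc 0 t → a ≤ b →
        IntervalIntegrable (fun r => S (t - r) (g r)) volume a b := fun a b ha hb hab =>
      ((hcont t ht0).mono (by rw [uIcc_of_le hab]; exact Icc_subset_Icc ha.1 hb.2)).intervalIntegrable
    have hi' : IntervalIntegrable (fun r => S (s - r) (g r)) volume 0 s :=
      ((hcont s hs0).mono (by rw [uIcc_of_le hs.1])).intervalIntegrable
    rw [hu t ht0, hu s hs0, map_add, ← ContinuousLinearMap.intervalIntegral_comp_comm _ hi']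
    have e1 : S (t - s) (S s (u 0)) = S t (u 0) := by
      rw [← ContinuousLinearMap.comp_apply, ← hS.add _ _ (sub_nonneg.2 ht.1.le) hs.1, sub_add_cancel]
    have e2 : ∫ r in (0 : ℝ)..s, S (t - s) (S (s - r) (g r)) = ∫ r in (0 : ℝ)..s, S (t - r) (g r) := by
      refine intervalIntegral.integral_congr fun r hr => ?_
      rw [uIcc_of_le hs.1] at hr
      rw [← ContinuousLinearMap.comp_apply, ← hS.add _ _ (sub_nonneg.2 ht.1.le) (sub_nonneg.2 hr.2)]
      congr 2; ring
    rw [e1, e2, ← intervalIntegral.integral_add_adjacent_intervals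
      (hi 0 s ⟨le_rfl, ht0.1⟩ ⟨hs.1, ht.1.le⟩ hs.1) (hi s t ⟨hs.1, ht.1.le⟩ ⟨ht0.1, le_rfl⟩ ht.1.le)]
    abel
  rw [Metric.tendsto_nhds]
  intro ε hε
  have h1 : ∀ᶠ r in 𝓝[Icc 0 T] s, ‖g r - g s‖ < ε / 4 := by
    have := (tendsto_iff_norm_sub_tendsto_zero.1 (hg s ⟨hs.1, hs.2.le⟩))
    exact this.eventually (gt_mem_nhds (by positivity))
  have h2 : ∀ᶠ h in 𝓝[≥] (0 : ℝ), ‖S h (g s) - g s‖ < ε / 4 :=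
    (tendsto_iff_norm_sub_tendsto_zero.1 (hS.tendsto_nhdsGE (g s))).eventually
      (gt_mem_nhds (by positivity))
  obtain ⟨δ₁, hδ₁, h1⟩ := Metric.mem_nhdsWithin_iff.1 h1
  obtain ⟨δ₂, hδ₂, h2⟩ := Metric.mem_nhdsWithin_iff.1 h2
  have hmem : Ioo s (min T (s + min δ₁ δ₂)) ∈ 𝓝[>] s :=
    Ioo_mem_nhdsGT (lt_min hs.2 (by linarith [lt_min hδ₁ hδ₂]))
  filter_upwards [hmem] with t ht
  have htT : t < T := ht.2.trans_le (min_le_left _ _)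
  have htδ : t < s + min δ₁ δ₂ := ht.2.trans_le (min_le_right _ _)
  have hts : 0 < t - s := sub_pos.2 ht.1
  have ht0 : t ∈ Icc 0 T := ⟨hs.1.trans ht.1.le, htT.le⟩
  -- Two errors of size `ε / 4` arise, one from freezing `g` at `s` and one from `S (t - r)` acting
  -- on `g s`. Their sum `ε / 2` leaves room for the strict bound by `ε`.
  have hbound : ‖∫ r in s..t, (S (t - r) (g r) - g s)‖ ≤ ε / 2 * |t - s| := by
    refine intervalIntegral.norm_integral_le_of_norm_le_const fun r hr => ?_
    rw [uIoc_of_le ht.1.le] at hr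
    have a1 : ‖g r - g s‖ < ε / 4 := h1 ⟨by
      rw [Metric.mem_ball, Real.dist_eq, abs_of_pos (sub_pos.2 hr.1)]
      linarith [hr.2, min_le_left δ₁ δ₂], ⟨hs.1.trans hr.1.le, hr.2.trans htT.le⟩⟩
    have a2 : ‖S (t - r) (g s) - g s‖ < ε / 4 := h2 ⟨by
      rw [Metric.mem_ball, Real.dist_eq, sub_zero, abs_of_nonneg (sub_nonneg.2 hr.2)]
      linarith [hr.1, min_le_right δ₁ δ₂], sub_nonneg.2 hr.2⟩
    calc ‖S (t - r) (g r) - g s‖ = ‖S (t - r) (g r - g s) + (S (t - r) (g s) - g s)‖ := by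
          rw [map_sub]; congr 1; abel
      _ ≤ ‖g r - g s‖ + ‖S (t - r) (g s) - g s‖ :=
          (norm_add_le _ _).trans (add_le_add_left (hc _ (sub_nonneg.2 hr.2) _) _)
      _ ≤ ε / 2 := by linarith
  have hi : IntervalIntegrable (fun r => S (t - r) (g r)) volume s t :=
    ((hcont t ht0).mono (by rw [uIcc_of_le ht.1.le]; exact Icc_subset_Icc_left hs.1)).intervalIntegrable
  rw [intervalIntegral.integral_sub hi intervalIntegrable_const, intervalIntegral.integral_const]
    at hbound
  rw [dist_eq_norm, hstep t ⟨ht.1, htT.le⟩]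
  have : (t - s)⁻¹ • (∫ r in s..t, S (t - r) (g r)) - g s
      = (t - s)⁻¹ • ((∫ r in s..t, S (t - r) (g r)) - (t - s) • g s) := by
    rw [smul_sub, smul_smul, inv_mul_cancel₀ hts.ne', one_smul]
  rw [this, norm_smul, norm_inv, Real.norm_eq_abs, inv_mul_lt_iff₀ (abs_pos.2 hts.ne')]
  rw [abs_of_pos hts] at hbound ⊢
  nlinarith

/-- Following a second semigroup with generator value `y` at `u` by `S` adds `h y + o(h)`. -/
theorem IsC0Semigroup.tendsto_comp (hS : IsC0Semigroup S)
    (hc : ∀ t, 0 ≤ t → ∀ f, ‖S t f‖ ≤ ‖f‖) {M : ℝ → X →L[ℝ] X} {f y : X}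
    (hM : Tendsto (fun h : ℝ => h⁻¹ • (M h f - f)) (𝓝[>] 0) (𝓝 y)) :
    Tendsto (fun h : ℝ => h⁻¹ • ((S h).comp (M h) f - S h f)) (𝓝[>] 0) (𝓝 y) := by
  refine (hS.tendsto_apply hc
    (tendsto_id.mono_right (nhdsWithin_mono _ Ioi_subset_Ici_self)) hM).congr fun h => ?_
  simp [map_sub]

end Semigroup

/-! ### Markov operators -/

/-- A positive and mass conserving operator on `L¹(ν)`. -/
structure IsMarkovOp {Ω : Type*} [MeasurableSpace Ω] (ν : Measure Ω)
    (V : Lp ℝ 1 ν →L[ℝ] Lp ℝ 1 ν) : Prop where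
  nonneg : ∀ f, 0 ≤ f → 0 ≤ V f
  mass : ∀ f, ∫ x, V f x ∂ν = ∫ x, f x ∂ν

section Markov

variable {Ω : Type*} [MeasurableSpace Ω] {ν : Measure Ω}

theorem IsAdjointMarkovSemigroup.isMarkovOp {S : ℝ → Lp ℝ 1 ν →L[ℝ] Lp ℝ 1 ν}
    (hS : IsAdjointMarkovSemigroup ν S) {t : ℝ} (ht : 0 ≤ t) : IsMarkovOp ν (S t) :=
  ⟨hS.nonneg t ht, hS.mass t ht⟩

theorem L1_norm_of_nonneg {f : Lp ℝ 1 ν} (hf : 0 ≤ f) : ‖f‖ = ∫ x, f x ∂ν := by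
  rw [L1.norm_eq_integral_norm]
  refine integral_congr_ae ?_
  filter_upwards [(Lp.coeFn_nonneg f).2 hf] with x hx
  exact abs_of_nonneg hx

variable {V W : Lp ℝ 1 ν →L[ℝ] Lp ℝ 1 ν}

theorem IsMarkovOp.comp (hV : IsMarkovOp ν V) (hW : IsMarkovOp ν W) : IsMarkovOp ν (V.comp W) :=
  ⟨fun f hf => hV.nonneg _ (hW.nonneg f hf), fun f => (hV.mass _).trans (hW.mass f)⟩

theorem IsMarkovOp.mono (hV : IsMarkovOp ν V) {f g : Lp ℝ 1 ν} (h : f ≤ g) : V f ≤ V g := by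
  have := hV.nonneg (g - f) (sub_nonneg.2 h)
  rwa [map_sub, sub_nonneg] at this

theorem IsMarkovOp.norm_of_nonneg (hV : IsMarkovOp ν V) {f : Lp ℝ 1 ν} (hf : 0 ≤ f) :
    ‖V f‖ = ‖f‖ := by
  rw [L1_norm_of_nonneg hf, L1_norm_of_nonneg (hV.nonneg f hf), hV.mass]

theorem norm_posPart_le_of_le {E : Type*} [NormedAddCommGroup E] [Lattice E] [HasSolidNorm E]
    [IsOrderedAddMonoid E] {a b : E} (h : a ≤ b) : ‖a⁺‖ ≤ ‖b⁺‖ :=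
  norm_le_norm_of_abs_le_abs (by
    rw [abs_of_nonneg (posPart_nonneg a), abs_of_nonneg (posPart_nonneg b)]
    exact posPart_mono h)

/-- Positivity gives `V f ≤ V f⁺`, and mass conservation preserves the norm of the nonnegative `f⁺`.
Applied to `f` and `-f`, this gives contractivity; on its own it drives the comparison principle. -/
theorem IsMarkovOp.norm_posPart_le (hV : IsMarkovOp ν V) (f : Lp ℝ 1 ν) : ‖(V f)⁺‖ ≤ ‖f⁺‖ := by
  rw [← hV.norm_of_nonneg (posPart_nonneg f)]
  refine (norm_posPart_le_of_le (hV.mono (le_posPart f))).trans_eq ?_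
  rw [posPart_eq_self.2 (hV.nonneg _ (posPart_nonneg f))]

theorem L1_norm_eq_posPart_add_negPart (f : Lp ℝ 1 ν) : ‖f‖ = ‖f⁺‖ + ‖f⁻‖ := by
  rw [← norm_abs_eq_norm f, ← posPart_add_negPart f, L1_norm_of_nonneg (posPart_nonneg f),
    L1_norm_of_nonneg (negPart_nonneg f),
    L1_norm_of_nonneg (add_nonneg (posPart_nonneg f) (negPart_nonneg f)),
    ← integral_add (L1.integrable_coeFn _) (L1.integrable_coeFn _)]
  exact integral_congr_ae (Lp.coeFn_add _ _)

theorem IsMarkovOp.norm_le (hV : IsMarkovOp ν V) (f : Lp ℝ 1 ν) : ‖V f‖ ≤ ‖f‖ := by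
  rw [L1_norm_eq_posPart_add_negPart (V f), L1_norm_eq_posPart_add_negPart f]
  refine add_le_add (hV.norm_posPart_le f) ?_
  have := hV.norm_posPart_le (-f)
  rwa [map_neg, posPart_neg, posPart_neg] at this

end Markov

/-! ### Order bounds and conservation of mass along approximate Markov evolutions -/

section Comparison

variable {Ω : Type*} [MeasurableSpace Ω] {ν : Measure Ω}

theorem Lp_smul_nonneg {c : ℝ} (hc : 0 ≤ c) {f : Lp ℝ 1 ν} (hf : 0 ≤ f) : 0 ≤ c • f := by
  rw [← Lp.coeFn_nonneg] at hf ⊢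
  filter_upwards [hf, Lp.coeFn_smul c f] with x hx h
  rw [h]
  exact mul_nonneg hc hx

theorem norm_posPart_add_le {E : Type*} [NormedAddCommGroup E] [Lattice E] [HasSolidNorm E]
    [IsOrderedAddMonoid E] (a b : E) : ‖(a + b)⁺‖ ≤ ‖a⁺‖ + ‖b⁺‖ := by
  refine (norm_posPart_le_of_le (add_le_add (le_posPart a) (le_posPart b))).trans ?_
  rw [posPart_eq_self.2 (add_nonneg (posPart_nonneg a) (posPart_nonneg b))]
  exact norm_add_le _ _

theorem norm_posPart_le_norm {E : Type*} [NormedAddCommGroup E] [Lattice E] [HasSolidNorm E]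
    [IsOrderedAddMonoid E] (a : E) : ‖a⁺‖ ≤ ‖a‖ := by
  simpa using lipschitzWith_posPart.dist_le_mul a 0

theorem Lp_norm_posPart_smul_le {c : ℝ} (hc : 0 ≤ c) (f : Lp ℝ 1 ν) :
    ‖(c • f)⁺‖ ≤ c * ‖f⁺‖ := by
  have h : c • f ≤ c • f⁺ := by
    rw [← sub_nonneg, ← smul_sub]
    exact Lp_smul_nonneg hc (sub_nonneg.2 (le_posPart f))
  refine (norm_posPart_le_of_le h).trans ?_
  refine (norm_posPart_le_norm _).trans ?_
  rw [norm_smul, Real.norm_eq_abs, abs_of_nonneg hc]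

/-- A continuous function whose upper right derivative is at most `0` does not increase. -/
theorem le_of_slope_le_tendsto_zero {f : ℝ → ℝ} {T : ℝ} (hf : ContinuousOn f (Icc 0 T))
    (h : ∀ s ∈ Ico 0 T, ∃ e : ℝ → ℝ, Tendsto e (𝓝[>] s) (𝓝 0) ∧
      ∀ᶠ t in 𝓝[>] s, f t ≤ f s + (t - s) * e t) : ∀ t ∈ Icc 0 T, f t ≤ f 0 := by
  refine fun t ht => image_le_of_liminf_slope_right_le_deriv_boundary hf (B := fun _ => f 0)
    (B' := fun _ => 0) le_rfl continuousOn_const (fun x _ => hasDerivWithinAt_const _ _ _) ?_ ht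
  intro s hs r hr
  obtain ⟨e, he, hle⟩ := h s hs
  refine Eventually.frequently ?_
  filter_upwards [hle, he.eventually (gt_mem_nhds hr), self_mem_nhdsWithin] with t h1 h2 h3
  have h4 : 0 < t - s := sub_pos.2 (mem_Ioi.1 h3)
  rw [slope_def_field, div_lt_iff₀ h4]
  nlinarith

/-- Comparison principle: since `V h 1 = 1 + h k + o(h)` with `|k| ≤ κ`, the choice `φ' = -κ |φ|`
makes `φ • 1` a subsolution whatever the sign of `φ`. Hence the mass of `(φ • 1 - ρ)⁺` cannot grow.
-/
theorem const_le_of_step [IsFiniteMeasure ν] {T κ : ℝ} {ρ : ℝ → Lp ℝ 1 ν}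
    (hρ : ContinuousOn ρ (Icc 0 T))
    {φ : ℝ → ℝ} (hφ : ∀ t, HasDerivAt φ (-(κ * |φ t|)) t)
    (hstep : ∀ s ∈ Ico 0 T, ∃ V : ℝ → Lp ℝ 1 ν →L[ℝ] Lp ℝ 1 ν, (∀ h, 0 < h → IsMarkovOp ν (V h)) ∧
      Tendsto (fun t => (t - s)⁻¹ • (ρ t - V (t - s) (ρ s))) (𝓝[>] s) (𝓝 0) ∧
      ∃ k : Lp ℝ 1 ν, -(κ • Lp.const 1 ν (1 : ℝ)) ≤ k ∧ k ≤ κ • Lp.const 1 ν (1 : ℝ) ∧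
        Tendsto (fun h : ℝ => h⁻¹ • (V h (Lp.const 1 ν (1 : ℝ)) - Lp.const 1 ν (1 : ℝ)))
          (𝓝[>] 0) (𝓝 k))
    (h0 : φ 0 • Lp.const 1 ν (1 : ℝ) ≤ ρ 0) :
    ∀ t ∈ Icc 0 T, φ t • Lp.const 1 ν (1 : ℝ) ≤ ρ t := by
  set one : Lp ℝ 1 ν := Lp.const 1 ν (1 : ℝ) with hone
  have hφc : Continuous φ := continuous_iff_continuousAt.2 fun t => (hφ t).continuousAt
  have hmain : ∀ t ∈ Icc 0 T, ‖(φ t • one - ρ t)⁺‖ ≤ ‖(φ 0 • one - ρ 0)⁺‖ := by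
    refine le_of_slope_le_tendsto_zero (f := fun t => ‖(φ t • one - ρ t)⁺‖) ?_ ?_
    · exact (continuous_posPart.comp_continuousOn
        ((hφc.smul continuous_const).continuousOn.sub hρ)).norm
    intro s hs
    obtain ⟨V, hV, hVρ, k, hk1, hk2, hVk⟩ := hstep s hs
    -- The defect of `φ • 1` along `V`, namely `φ t • 1 - V (t - s) (φ s • 1)`, divided by `t - s`.
    -- Its limit is nonpositive, so its positive part tends to zero.
    set R : ℝ → Lp ℝ 1 ν := fun t =>
      ((t - s)⁻¹ * (φ t - φ s)) • one - φ s • ((t - s)⁻¹ • (V (t - s) one - one)) with hR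
    have hRlim : Tendsto R (𝓝[>] s) (𝓝 ((-(κ * |φ s|)) • one - φ s • k)) := by
      refine Tendsto.sub (Tendsto.smul_const ?_ _)
        ((hVk.comp (tendsto_sub_nhdsGT_zero s)).const_smul _)
      have := (hasDerivWithinAt_iff_tendsto_slope.1 ((hφ s).hasDerivWithinAt (s := Ioi s)))
      rw [sdiff_singleton_eq_self self_notMem_Ioi] at this
      refine this.congr fun t => ?_
      rw [slope_def_field, div_eq_inv_mul]
    have hneg : (-(κ * |φ s|)) • one - φ s • k ≤ 0 := by
      rcases le_total 0 (φ s) with h | h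
      · have := Lp_smul_nonneg h (sub_nonneg.2 hk1)
        rw [abs_of_nonneg h, ← neg_nonneg]
        convert this using 1
        module
      · have := Lp_smul_nonneg (neg_nonneg.2 h) (sub_nonneg.2 hk2)
        rw [abs_of_nonpos h, ← neg_nonneg]
        convert this using 1
        module
    refine ⟨fun t => ‖(t - s)⁻¹ • (ρ t - V (t - s) (ρ s))‖ + ‖(R t)⁺‖, ?_, ?_⟩
    · have h1 := ((continuous_posPart.tendsto _).comp hRlim).norm
      rw [posPart_eq_zero.2 hneg, norm_zero] at h1
      have h2 := hVρ.norm.add h1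
      rwa [norm_zero, add_zero] at h2
    · filter_upwards [self_mem_nhdsWithin] with t ht
      have hts : 0 < t - s := sub_pos.2 (mem_Ioi.1 ht)
      have hc : (t - s) * (t - s)⁻¹ = 1 := mul_inv_cancel₀ hts.ne'
      have e : φ t • one - ρ t = V (t - s) (φ s • one - ρ s) + (t - s) • R t
          + (-((t - s) • ((t - s)⁻¹ • (ρ t - V (t - s) (ρ s))))) := by
        rw [hR, map_sub, map_smul, smul_sub, smul_smul, ← mul_assoc, hc, one_mul,
          smul_comm (t - s) (φ s), smul_smul (t - s), hc, one_smul, smul_smul (t - s), hc, one_smul]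
        module
      rw [e]
      refine (norm_posPart_add_le _ _).trans ?_
      refine (add_le_add (norm_posPart_add_le _ _) (norm_posPart_le_norm _)).trans ?_
      have h1 := (hV _ hts).norm_posPart_le (φ s • one - ρ s)
      have h2 := Lp_norm_posPart_smul_le hts.le (R t)
      have h3 : ‖-((t - s) • ((t - s)⁻¹ • (ρ t - V (t - s) (ρ s))))‖
          = (t - s) * ‖(t - s)⁻¹ • (ρ t - V (t - s) (ρ s))‖ := by
        rw [norm_neg, norm_smul, Real.norm_eq_abs, abs_of_pos hts]
      rw [h3]
      linarith
  intro t ht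
  have h1 := hmain t ht
  rw [posPart_eq_zero.2 (sub_nonpos.2 h0), norm_zero] at h1
  exact sub_nonpos.1 (posPart_eq_zero.1 (norm_le_zero_iff.1 h1))

theorem continuous_integral_Lp : Continuous fun f : Lp ℝ 1 ν => ∫ x, f x ∂ν :=
  continuous_integral

theorem abs_integral_Lp_le (f : Lp ℝ 1 ν) : |∫ x, f x ∂ν| ≤ ‖f‖ := by
  rw [L1.norm_eq_integral_norm, ← Real.norm_eq_abs]
  exact norm_integral_le_integral_norm _

theorem integral_Lp_sub (f g : Lp ℝ 1 ν) :
    ∫ x, (f - g) x ∂ν = ∫ x, f x ∂ν - ∫ x, g x ∂ν := by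
  rw [← integral_sub (L1.integrable_coeFn _) (L1.integrable_coeFn _)]
  exact integral_congr_ae (Lp.coeFn_sub f g)

/-- Each `V h` preserves mass, so the mass changes by `o(t - s)` in either direction; the one-sided
derivative criterion applies to the integral and to its negative. -/
theorem integral_eq_of_step {T : ℝ} {ρ : ℝ → Lp ℝ 1 ν} (hρ : ContinuousOn ρ (Icc 0 T))
    (hstep : ∀ s ∈ Ico 0 T, ∃ V : ℝ → Lp ℝ 1 ν →L[ℝ] Lp ℝ 1 ν, (∀ h, 0 < h → IsMarkovOp ν (V h)) ∧
      Tendsto (fun t => (t - s)⁻¹ • (ρ t - V (t - s) (ρ s))) (𝓝[>] s) (𝓝 0)) :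
    ∀ t ∈ Icc 0 T, ∫ x, ρ t x ∂ν = ∫ x, ρ 0 x ∂ν := by
  have key : ∀ s ∈ Ico 0 T, ∃ e : ℝ → ℝ, Tendsto e (𝓝[>] s) (𝓝 0) ∧
      ∀ᶠ t in 𝓝[>] s, |∫ x, ρ t x ∂ν - ∫ x, ρ s x ∂ν| ≤ (t - s) * e t := by
    intro s hs
    obtain ⟨V, hV, hVρ⟩ := hstep s hs
    refine ⟨_, by simpa using hVρ.norm, ?_⟩
    filter_upwards [self_mem_nhdsWithin] with t ht
    have hts : 0 < t - s := sub_pos.2 (mem_Ioi.1 ht)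
    rw [← (hV _ hts).mass (ρ s), ← integral_Lp_sub]
    refine (abs_integral_Lp_le _).trans_eq ?_
    rw [norm_smul, norm_inv, Real.norm_eq_abs, abs_of_pos hts, mul_inv_cancel_left₀ hts.ne']
  have hc : ContinuousOn (fun t => ∫ x, ρ t x ∂ν) (Icc 0 T) :=
    continuous_integral_Lp.comp_continuousOn hρ
  intro t ht
  refine le_antisymm (le_of_slope_le_tendsto_zero hc ?_ t ht)
    (neg_le_neg_iff.1 (le_of_slope_le_tendsto_zero hc.neg ?_ t ht))
  · intro s hs
    obtain ⟨e, he, hle⟩ := key s hs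
    refine ⟨e, he, hle.mono fun t ht => ?_⟩
    linarith [(abs_le.1 ht).2]
  · intro s hs
    obtain ⟨e, he, hle⟩ := key s hs
    refine ⟨e, he, hle.mono fun t ht => ?_⟩
    simp only [Pi.neg_apply]
    linarith [(abs_le.1 ht).1]

end Comparison

/-! ### Truncated relative entropy -/

/-- The truncation of `u` to the interval `[m⁻¹, m]`. -/
noncomputable def truncRatio (m u : ℝ) : ℝ := max m⁻¹ (min u m)

/-- The entropy density `max {(log a + 1) r - a s | m⁻¹ ≤ a ≤ m}`; without the constraint on `a`
this is `r log (r / s)`. -/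
noncomputable def truncEntropy (m r s : ℝ) : ℝ :=
  (Real.log (truncRatio m (r / s)) + 1) * r - truncRatio m (r / s) * s

/-! ### Pointwise estimates for the truncated entropy density -/

section Pointwise

variable {m : ℝ}

theorem inv_le_truncRatio (m u : ℝ) : m⁻¹ ≤ truncRatio m u := le_max_left _ _

theorem truncRatio_le (hm : 1 ≤ m) (u : ℝ) : truncRatio m u ≤ m :=
  max_le ((inv_le_one_of_one_le₀ hm).trans hm) (min_le_right _ _)

theorem truncRatio_pos (hm : 1 ≤ m) (u : ℝ) : 0 < truncRatio m u :=
  (inv_pos.2 (zero_lt_one.trans_le hm)).trans_le (inv_le_truncRatio m u)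

theorem truncRatio_le_add_one (hm : 1 ≤ m) {u : ℝ} (hu : 0 ≤ u) : truncRatio m u ≤ u + 1 :=
  max_le ((inv_le_one_of_one_le₀ hm).trans (by linarith)) ((min_le_left _ _).trans (by linarith))

theorem abs_log_add_one_le (hm : 1 ≤ m) {a : ℝ} (ha : m⁻¹ ≤ a) (ha' : a ≤ m) :
    |Real.log a + 1| ≤ Real.log m + 1 := by
  have hm0 : 0 < m := zero_lt_one.trans_le hm
  have h1 := Real.log_le_log (inv_pos.2 hm0) ha
  have h2 := Real.log_le_log ((inv_pos.2 hm0).trans_le ha) ha'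
  rw [Real.log_inv] at h1
  rw [abs_le]
  constructor <;> linarith

/-- For `s > 0` the function `a ↦ (log a + 1) r - a s` has derivative `r / a - s`, so on `[m⁻¹, m]`
it is largest at the projection of `r / s`. No sign of `r` is needed. -/
theorem le_truncEntropy (hm : 1 ≤ m) {a r s : ℝ} (ha : m⁻¹ ≤ a) (ha' : a ≤ m) (hs : 0 < s) :
    (Real.log a + 1) * r - a * s ≤ truncEntropy m r s := by
  have hm0 : 0 < m := zero_lt_one.trans_le hm
  have ha0 : 0 < a := (inv_pos.2 hm0).trans_le ha
  set u := r / s with hu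
  set c := truncRatio m u with hc
  have hc0 : 0 < c := truncRatio_pos hm u
  have hr : r = u * s := by rw [hu, div_mul_cancel₀ _ hs.ne']
  -- Variational inequality for the projection `c` of `u`, transported by monotonicity of `log`: if
  -- `u < c` then `c` is the left endpoint, and if `u > c` it is the right one.
  have h1 : (u - c) * (Real.log a - Real.log c) ≤ 0 := by
    rcases le_total u c with h | h
    · rcases h.eq_or_lt with h | h
      · simp [h]
      · have : c = m⁻¹ ∨ c = m := by
          rw [hc, truncRatio] at h ⊢
          rcases max_choice m⁻¹ (min u m) with h' | h'
          · exact Or.inl h'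
          · rw [h'] at h ⊢
            exact absurd (min_le_left u m) (not_le.2 h)
        rcases this with h' | h'
        · have := Real.log_le_log hc0 (h'.trans_le ha)
          nlinarith
        · have h3 : m⁻¹ = c := by
            rw [hc, truncRatio] at h h' ⊢
            rcases max_choice m⁻¹ (min u m) with h'' | h''
            · exact h''.symm
            · rw [h''] at h
              exact absurd (min_le_left u m) (not_le.2 h)
          have := Real.log_le_log hc0 (h3.symm.trans_le ha)
          nlinarith
    · rcases h.eq_or_lt with h | h
      · simp [h]
      · have : m ≤ c := by
          by_contra hlt
          rw [hc, truncRatio, not_le, max_lt_iff, min_lt_iff] at hlt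
          rcases hlt.2 with h' | h'
          · have : min u m = u := min_eq_left h'.le
            have : u ≤ c := by rw [hc, truncRatio, this]; exact le_max_right _ _
            linarith
          · exact lt_irrefl _ h'
        have := Real.log_le_log ha0 (ha'.trans this)
        nlinarith
  have h2 : c * (Real.log a - Real.log c) ≤ a - c := by
    have := Real.log_le_sub_one_of_pos (div_pos ha0 hc0)
    rw [Real.log_div ha0.ne' hc0.ne'] at this
    calc c * (Real.log a - Real.log c) ≤ c * (a / c - 1) := by gcongr
      _ = a - c := by field_simp
  have h3 : u * (Real.log a - Real.log c) ≤ a - c := by linarith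
  have h4 : s * (u * (Real.log a - Real.log c)) ≤ s * (a - c) := by gcongr
  rw [truncEntropy, ← hu, ← hc, hr]
  linarith

/-- The same duality without cutoff, from `log x ≤ x - 1` at `x = a s / r`. It bounds the truncation
by the entropy density and later gives the Gibbs principle. -/
theorem young_entropy {a r s : ℝ} (ha : 0 < a) (hr : 0 ≤ r) (hs : 0 < s) :
    (Real.log a + 1) * r - a * s ≤ r * Real.log (r / s) := by
  rcases hr.eq_or_lt with rfl | hr
  · simp [(mul_pos ha hs).le]
  · have := Real.log_le_sub_one_of_pos (div_pos (mul_pos ha hs) hr)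
    rw [Real.log_div (mul_pos ha hs).ne' hr.ne', Real.log_mul ha.ne' hs.ne'] at this
    rw [Real.log_div hr.ne' hs.ne']
    have h2 : r * (Real.log a + Real.log s - Real.log r) ≤ r * (a * s / r - 1) := by gcongr
    have h3 : r * (a * s / r - 1) = a * s - r := by field_simp
    linarith

theorem truncEntropy_le (hm : 1 ≤ m) {r s : ℝ} (hr : 0 ≤ r) (hs : 0 < s) :
    truncEntropy m r s ≤ r * Real.log (r / s) :=
  young_entropy (truncRatio_pos hm _) hr hs

/-- Test with `a = 1`. Subtracting `r - s`, whose integral vanishes for two probability densities,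
makes the truncated density nonnegative, as Fatou's lemma requires. -/
theorem sub_le_truncEntropy (hm : 1 ≤ m) {r s : ℝ} (hs : 0 < s) : r - s ≤ truncEntropy m r s := by
  simpa using le_truncEntropy hm (a := 1) (r := r) (inv_le_one_of_one_le₀ hm) hm hs

/-- The maximiser for the pair with the larger value competes for the other pair, so the difference
is bounded by a linear form with coefficients at most `log m + 1` and `m`. -/
theorem abs_truncEntropy_sub_le (hm : 1 ≤ m) {r s r' s' : ℝ} (hs : 0 < s) (hs' : 0 < s') :
    |truncEntropy m r s - truncEntropy m r' s'| ≤
      (Real.log m + 1) * |r - r'| + m * |s - s'| := by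
  wlog h : truncEntropy m r' s' ≤ truncEntropy m r s generalizing r s r' s'
  · rw [abs_sub_comm, abs_sub_comm r, abs_sub_comm s]
    exact this hs' hs (le_of_not_ge h)
  rw [abs_of_nonneg (sub_nonneg.2 h)]
  have h0 := inv_le_truncRatio m (r / s)
  have h1 := truncRatio_le hm (r / s)
  have h2 := le_truncEntropy (r := r') hm h0 h1 hs'
  have h3 := abs_log_add_one_le hm h0 h1
  have h4 : (Real.log (truncRatio m (r / s)) + 1) * (r - r') ≤ (Real.log m + 1) * |r - r'| :=
    (le_abs_self _).trans (by rw [abs_mul]; gcongr)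
  have h5 : truncRatio m (r / s) * (s' - s) ≤ m * |s - s'| := by
    rw [abs_sub_comm]
    exact (le_abs_self _).trans (by rw [abs_mul, abs_of_pos (truncRatio_pos hm _)]; gcongr)
  rw [truncEntropy]
  linarith

theorem abs_truncRatio_sub_le (hm : 1 ≤ m) {c r s r' s' : ℝ} (hc : 0 < c) (hs : c ≤ s)
    (hs' : c ≤ s') :
    |truncRatio m (r / s) - truncRatio m (r' / s')| ≤ c⁻¹ * (|r - r'| + m * |s - s'|) := by
  have hm0 : 0 < m := zero_lt_one.trans_le hm
  wlog h : truncRatio m (r' / s') < truncRatio m (r / s) generalizing r s r' s'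
  · rcases (not_lt.1 h).eq_or_lt with h | h
    · rw [h, sub_self, abs_zero]; positivity
    · rw [abs_sub_comm, abs_sub_comm r, abs_sub_comm s]
      exact this hs' hs h
  rw [abs_of_nonneg (sub_nonneg.2 h.le), ← div_eq_inv_mul, le_div_iff₀ hc]
  -- The larger truncated value is not the floor `m⁻¹`, so it is at most its ratio; the smaller is
  -- not the ceiling `m`, so it is at least its ratio. Clearing denominators leaves a linear
  -- estimate.
  have hv : truncRatio m (r / s) ≤ r / s := by
    have h1 : m⁻¹ < truncRatio m (r / s) := (inv_le_truncRatio _ _).trans_lt h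
    rw [truncRatio] at h1 ⊢
    rw [max_eq_right ((lt_max_iff.1 h1).resolve_left (lt_irrefl _)).le]
    exact min_le_left _ _
  have hv' : r' / s' ≤ truncRatio m (r' / s') := by
    have h1 : truncRatio m (r' / s') < m := h.trans_le (truncRatio_le hm _)
    rw [truncRatio] at h1 ⊢
    have h2 : r' / s' < m := (min_lt_iff.1 (max_lt_iff.1 h1).2).resolve_right (lt_irrefl _)
    rw [min_eq_left h2.le]
    exact le_max_right _ _
  rw [le_div_iff₀ (hc.trans_le hs)] at hv
  rw [div_le_iff₀ (hc.trans_le hs')] at hv'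
  have h3 := truncRatio_le hm (r' / s')
  have h4 := truncRatio_pos hm (r' / s')
  have h5 : truncRatio m (r' / s') * (s' - s) ≤ m * |s - s'| := by
    rw [abs_sub_comm]
    exact (le_abs_self _).trans (by rw [abs_mul, abs_of_pos h4]; gcongr)
  have h6 := le_abs_self (r - r')
  have h7 : (truncRatio m (r / s) - truncRatio m (r' / s')) * c
      ≤ (truncRatio m (r / s) - truncRatio m (r' / s')) * s :=
    mul_le_mul_of_nonneg_left hs (sub_nonneg.2 h.le)
  linarith

theorem tendsto_truncRatio {u : ℝ} (hu : 0 ≤ u) :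
    Tendsto (fun n : ℕ => truncRatio ((n : ℝ) + 1) u) atTop (𝓝 u) := by
  have h1 : Tendsto (fun n : ℕ => ((n : ℝ) + 1)⁻¹) atTop (𝓝 0) := by
    simpa using tendsto_one_div_add_atTop_nhds_zero_nat (𝕜 := ℝ)
  have h2 : Tendsto (fun n : ℕ => min u ((n : ℝ) + 1)) atTop (𝓝 u) := by
    refine tendsto_const_nhds.congr' ?_
    filter_upwards [eventually_ge_atTop ⌈u⌉₊] with n hn
    rw [min_eq_left]
    have := Nat.le_of_ceil_le hn
    linarith
  have := h1.max h2
  rwa [max_eq_right hu] at this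

theorem tendsto_truncEntropy {r s : ℝ} (hr : 0 ≤ r) (hs : 0 < s) :
    Tendsto (fun n : ℕ => truncEntropy ((n : ℝ) + 1) r s) atTop (𝓝 (r * Real.log (r / s))) := by
  have h1 := tendsto_truncRatio (div_nonneg hr hs.le)
  -- At `r = 0` the truncated ratio tends to `0`, where `log` is singular, but the logarithmic term
  -- carries the factor `r`.
  rcases hr.eq_or_lt with rfl | hr
  · have := h1.mul_const s
    simp only [truncEntropy]
    simpa using this.neg
  · have h2 := (((Real.continuousAt_log (div_pos hr hs).ne').tendsto.comp h1).add_const 1).mul_const r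
    have h3 := h2.sub (h1.mul_const s)
    have e : (Real.log (r / s) + 1) * r - r / s * s = r * Real.log (r / s) := by
      rw [div_mul_cancel₀ _ hs.ne']; ring
    rwa [e] at h3

end Pointwise

/-! ### Integrated truncated entropy: data processing and continuity in time -/

section Integral

variable {Ω : Type*} [MeasurableSpace Ω] {ν : Measure Ω} {m : ℝ}

theorem measurable_truncRatio (m : ℝ) : Measurable (truncRatio m) :=
  measurable_const.max (measurable_id.min measurable_const)

theorem Lp_measurable (f : Lp ℝ 1 ν) : Measurable f := (Lp.stronglyMeasurable f).measurable

theorem measurable_truncRatio_Lp (m : ℝ) (r s : Lp ℝ 1 ν) :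
    Measurable fun x => truncRatio m (r x / s x) :=
  (measurable_truncRatio m).comp ((Lp_measurable r).div (Lp_measurable s))

theorem measurable_truncEntropy (m : ℝ) (r s : Lp ℝ 1 ν) :
    Measurable fun x => truncEntropy m (r x) (s x) :=
  (((Real.measurable_log.comp (measurable_truncRatio_Lp m r s)).add_const 1).mul
    (Lp_measurable r)).sub ((measurable_truncRatio_Lp m r s).mul (Lp_measurable s))

theorem integrable_truncRatio_mul (hm : 1 ≤ m) (r s : Lp ℝ 1 ν) {d : Ω → ℝ}
    (hd : Integrable d ν) : Integrable (fun x => truncRatio m (r x / s x) * d x) ν :=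
  hd.bdd_mul (measurable_truncRatio_Lp m r s).aestronglyMeasurable
    (c := m) (Eventually.of_forall fun x => by
      rw [Real.norm_eq_abs, abs_of_pos (truncRatio_pos hm _)]; exact truncRatio_le hm _)

theorem integrable_log_truncRatio_mul (hm : 1 ≤ m) (r s : Lp ℝ 1 ν) {d : Ω → ℝ}
    (hd : Integrable d ν) :
    Integrable (fun x => (Real.log (truncRatio m (r x / s x)) + 1) * d x) ν :=
  hd.bdd_mul ((Real.measurable_log.comp
      (measurable_truncRatio_Lp m r s)).add_const 1).aestronglyMeasurable
    (c := Real.log m + 1) (Eventually.of_forall fun _ =>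
      abs_log_add_one_le hm (inv_le_truncRatio _ _) (truncRatio_le hm _))

theorem integrable_truncEntropy (hm : 1 ≤ m) (r s : Lp ℝ 1 ν) :
    Integrable (fun x => truncEntropy m (r x) (s x)) ν :=
  (integrable_log_truncRatio_mul hm r s (L1.integrable_coeFn r)).sub
    (integrable_truncRatio_mul hm r s (L1.integrable_coeFn s))

theorem L1_norm_sub (f g : Lp ℝ 1 ν) : ‖f - g‖ = ∫ x, |f x - g x| ∂ν := by
  rw [L1.norm_eq_integral_norm]
  refine integral_congr_ae ?_
  filter_upwards [Lp.coeFn_sub f g] with x hx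
  rw [hx]; rfl

/-- The data processing inequality for the truncated entropy, in pointwise form. -/
theorem IsMarkovOp.truncEntropy_le {V : Lp ℝ 1 ν →L[ℝ] Lp ℝ 1 ν} (hV : IsMarkovOp ν V)
    (hm : 1 ≤ m) (r s : Lp ℝ 1 ν) (hs : ∀ᵐ x ∂ν, 0 < s x) :
    ∀ᵐ x ∂ν, ∀ a ∈ Icc m⁻¹ m, (Real.log a + 1) * V r x - a * V s x
      ≤ V ((integrable_truncEntropy hm r s).toL1 _) x := by
  set w := (integrable_truncEntropy hm r s).toL1 _ with hw
  have h1 : ∀ a ∈ Icc m⁻¹ m, ∀ᵐ x ∂ν, (Real.log a + 1) * V r x - a * V s x ≤ V w x := by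
    intro a ha
    -- For fixed `a` this linear minorant is preserved by the positive operator `V`; no Jensen
    -- inequality is needed.
    have hle : (Real.log a + 1) • r - a • s ≤ w := by
      rw [← Lp.coeFn_le]
      filter_upwards [(integrable_truncEntropy hm r s).coeFn_toL1, hs,
        Lp.coeFn_sub ((Real.log a + 1) • r) (a • s), Lp.coeFn_smul (Real.log a + 1) r,
        Lp.coeFn_smul a s] with x h1 h2 h3 h4 h5
      rw [hw, h1, h3, Pi.sub_apply, h4, h5]
      exact le_truncEntropy hm ha.1 ha.2 h2
    have := hV.mono hle
    rw [map_sub, map_smul, map_smul, ← Lp.coeFn_le] at this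
    filter_upwards [this, Lp.coeFn_sub ((Real.log a + 1) • V r) (a • V s),
      Lp.coeFn_smul (Real.log a + 1) (V r), Lp.coeFn_smul a (V s)] with x h2 h3 h4 h5
    rw [h3, Pi.sub_apply, h4, h5] at h2
    exact h2
  -- The exceptional null set depends on `a`. A countable dense set of values gives a common one,
  -- and continuity in `a` recovers the whole interval.
  obtain ⟨D, hD, hDc, hDd⟩ :=
    (TopologicalSpace.IsSeparable.of_separableSpace (Icc m⁻¹ m)).exists_countable_dense_subset
  have h2 : ∀ᵐ x ∂ν, ∀ a ∈ D, (Real.log a + 1) * V r x - a * V s x ≤ V w x :=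
    (ae_ball_iff hDc).2 fun a ha => h1 a (hD ha)
  filter_upwards [h2] with x hx a ha
  have hsub : closure D ⊆ Icc m⁻¹ m := closure_minimal hD isClosed_Icc
  refine le_on_closure (f := fun a => (Real.log a + 1) * V r x - a * V s x)
    (g := fun _ => V w x) hx ?_ continuousOn_const (hDd ha)
  have hlog : ContinuousOn Real.log (closure D) := Real.continuousOn_log.mono fun a ha =>
    ((inv_pos.2 (zero_lt_one.trans_le hm)).trans_le (hsub ha).1).ne'
  fun_prop

/-- Evaluate data processing at the maximiser for the new pair `(r', s')`. The two errors then enter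
linearly; the one in `s'` is kept exactly because it carries the first-order drift. -/
theorem IsMarkovOp.integral_truncEntropy_le {V : Lp ℝ 1 ν →L[ℝ] Lp ℝ 1 ν} (hV : IsMarkovOp ν V)
    (hm : 1 ≤ m) (r s r' s' : Lp ℝ 1 ν) (hs : ∀ᵐ x ∂ν, 0 < s x) :
    ∫ x, truncEntropy m (r' x) (s' x) ∂ν ≤ ∫ x, truncEntropy m (r x) (s x) ∂ν
      + (Real.log m + 1) * ‖r' - V r‖
      + ∫ x, truncRatio m (r' x / s' x) * (V s - s' : Lp ℝ 1 ν) x ∂ν := by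
  set w := (integrable_truncEntropy hm r s).toL1 _ with hw
  have hwi : ∫ x, truncEntropy m (r x) (s x) ∂ν = ∫ x, V w x ∂ν := by
    rw [hV.mass]
    exact (integral_congr_ae (integrable_truncEntropy hm r s).coeFn_toL1).symm
  have hi1 := integrable_truncRatio_mul hm r' s' (L1.integrable_coeFn (V s - s'))
  have hi2 : Integrable (fun x => (Real.log m + 1) * |(r' - V r : Lp ℝ 1 ν) x|) ν :=
    (L1.integrable_coeFn (r' - V r)).abs.const_mul _
  have hi3 : Integrable (fun x => V w x + (Real.log m + 1) * |(r' - V r : Lp ℝ 1 ν) x|) ν :=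
    (L1.integrable_coeFn _).add hi2
  rw [hwi, L1.norm_eq_integral_norm, ← integral_const_mul]
  simp only [Real.norm_eq_abs]
  rw [← integral_add (L1.integrable_coeFn _) hi2, ← integral_add hi3 hi1]
  refine integral_mono_ae (integrable_truncEntropy hm r' s') (hi3.add hi1) ?_
  filter_upwards [hV.truncEntropy_le hm r s hs, Lp.coeFn_sub (V s) s', Lp.coeFn_sub r' (V r)]
    with x h1 h2 h3
  have h4 := inv_le_truncRatio m (r' x / s' x)
  have h5 := truncRatio_le hm (r' x / s' x)
  have h6 := h1 _ ⟨h4, h5⟩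
  have h7 : (Real.log (truncRatio m (r' x / s' x)) + 1) * (r' x - V r x)
      ≤ (Real.log m + 1) * |r' x - V r x| := by
    refine (le_abs_self _).trans ?_
    rw [abs_mul]
    gcongr
    exact abs_log_add_one_le hm h4 h5
  simp only [h2, h3, Pi.sub_apply]
  rw [truncEntropy]
  linarith

/-- Integrals of Lipschitz expressions in three `L¹`-continuous curves are continuous. -/
theorem continuousOn_integral_of_lipschitz {I : Set ℝ} {r s d : ℝ → Lp ℝ 1 ν}
    (hr : ContinuousOn r I) (hs : ContinuousOn s I) (hd : ContinuousOn d I) {F : ℝ → Ω → ℝ}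
    (hF : ∀ t ∈ I, Integrable (F t) ν) {C : ℝ}
    (hC : ∀ t ∈ I, ∀ t' ∈ I, ∀ᵐ x ∂ν, |F t x - F t' x| ≤
      C * (|r t x - r t' x| + |s t x - s t' x| + |d t x - d t' x|)) :
    ContinuousOn (fun t => ∫ x, F t x ∂ν) I := by
  intro t₀ ht₀
  rw [ContinuousWithinAt, tendsto_iff_norm_sub_tendsto_zero]
  have h : Tendsto (fun t => C * (‖r t - r t₀‖ + ‖s t - s t₀‖ + ‖d t - d t₀‖)) (𝓝[I] t₀)
      (𝓝 (C * (0 + 0 + 0))) :=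
    (((tendsto_iff_norm_sub_tendsto_zero.1 (hr t₀ ht₀)).add
      (tendsto_iff_norm_sub_tendsto_zero.1 (hs t₀ ht₀))).add
      (tendsto_iff_norm_sub_tendsto_zero.1 (hd t₀ ht₀))).const_mul C
  rw [add_zero, add_zero, mul_zero] at h
  refine squeeze_zero' (Eventually.of_forall fun _ => norm_nonneg _) ?_ h
  filter_upwards [self_mem_nhdsWithin] with t ht
  have hi : ∀ u : ℝ → Lp ℝ 1 ν, Integrable (fun x => |u t x - u t₀ x|) ν := fun u =>
    ((L1.integrable_coeFn _).sub (L1.integrable_coeFn _)).abs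
  have hi2 : Integrable (fun x => |r t x - r t₀ x| + |s t x - s t₀ x|) ν := (hi r).add (hi s)
  rw [← integral_sub (hF t ht) (hF t₀ ht₀), L1_norm_sub, L1_norm_sub, L1_norm_sub,
    ← integral_add (hi r) (hi s), ← integral_add hi2 (hi d), ← integral_const_mul]
  refine (norm_integral_le_integral_norm _).trans (integral_mono_ae
    ((hF t ht).sub (hF t₀ ht₀)).norm ((hi2.add (hi d)).const_mul C) ?_)
  exact hC t ht t₀ ht₀

/-- Comparison with the primitive of `g`; continuity of `g` turns `g t + e t` into the right
derivative at the base point. The free starting time later yields monotonicity on subintervals. -/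
theorem le_add_integral_of_slope {f g : ℝ → ℝ} {T : ℝ} (hf : ContinuousOn f (Icc 0 T))
    (hg : ContinuousOn g (Icc 0 T))
    (h : ∀ s ∈ Ico 0 T, ∃ e : ℝ → ℝ, Tendsto e (𝓝[>] s) (𝓝 0) ∧
      ∀ᶠ t in 𝓝[>] s, f t ≤ f s + (t - s) * (g t + e t)) {s t : ℝ} (hs : 0 ≤ s) (hst : s ≤ t)
    (ht : t ≤ T) : f t ≤ f s + ∫ r in s..t, g r := by
  have hsT := hst.trans ht
  have hsub : Icc s T ⊆ Icc 0 T := Icc_subset_Icc_left hs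
  refine image_le_of_liminf_slope_right_le_deriv_boundary (a := s) (b := T) (hf.mono hsub)
    (B := fun t => f s + ∫ r in s..t, g r) (B' := g) (by simp) ?_ ?_ ?_ ⟨hst, ht⟩
  · refine continuousOn_const.add ?_
    have := intervalIntegral.continuousOn_primitive_interval (μ := volume) (f := g) (a := s) (b := T)
      (by rw [uIcc_of_le hsT]; exact (hg.mono hsub).integrableOn_Icc)
    rwa [uIcc_of_le hsT] at this
  · intro x hx
    have hx0 : x ∈ Ico 0 T := ⟨hs.trans hx.1, hx.2⟩
    have hmem : Icc 0 T ∈ 𝓝[>] x := mem_of_superset (Ioo_mem_nhdsGT hx.2)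
      fun y hy => ⟨hx0.1.trans hy.1.le, hy.2.le⟩
    refine HasDerivWithinAt.const_add _ ?_
    refine intervalIntegral.integral_hasDerivWithinAt_right (t := Ioi x) ?_ ?_ ?_
    · exact (hg.mono (by rw [uIcc_of_le hx.1]; exact Icc_subset_Icc hs hx.2.le)).intervalIntegrable
    · exact ⟨Icc 0 T, hmem, hg.aestronglyMeasurable measurableSet_Icc⟩
    · exact (hg x ⟨hx0.1, hx0.2.le⟩).mono_of_mem_nhdsWithin hmem
  · intro x hx r hr
    have hx0 : x ∈ Ico 0 T := ⟨hs.trans hx.1, hx.2⟩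
    have hmem : Icc 0 T ∈ 𝓝[>] x := mem_of_superset (Ioo_mem_nhdsGT hx.2)
      fun y hy => ⟨hx0.1.trans hy.1.le, hy.2.le⟩
    obtain ⟨e, he, hle⟩ := h x hx0
    have hlim : Tendsto (fun t => g t + e t) (𝓝[>] x) (𝓝 (g x + 0)) :=
      Tendsto.add ((hg x ⟨hx0.1, hx0.2.le⟩).mono_of_mem_nhdsWithin hmem) he
    rw [add_zero] at hlim
    refine Eventually.frequently ?_
    filter_upwards [hle, hlim.eventually (gt_mem_nhds hr), self_mem_nhdsWithin] with t h1 h2 h3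
    have h4 : 0 < t - x := sub_pos.2 (mem_Ioi.1 h3)
    rw [slope_def_field, div_lt_iff₀ h4]
    nlinarith

end Integral

/-! ### The entropy inequality for approximate Markov evolutions -/

/-- A pointwise limit of functions that are bounded in `L¹` is integrable. -/
theorem integrable_of_tendsto_of_lintegral_le {Ω : Type*} [MeasurableSpace Ω] {μ : Measure Ω}
    {F : ℕ → Ω → ℝ} {f : Ω → ℝ} {C : ℝ≥0∞}
    (hlim : ∀ᵐ x ∂μ, Tendsto (fun n => F n x) atTop (𝓝 (f x)))
    (hF : ∀ n, AEStronglyMeasurable (F n) μ) (hC : C ≠ ∞)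
    (hle : ∀ n, ∫⁻ x, ‖F n x‖ₑ ∂μ ≤ C) : Integrable f μ := by
  refine ⟨aestronglyMeasurable_of_tendsto_ae _ hF hlim, lt_of_le_of_lt ?_ hC.lt_top⟩
  rw [lintegral_congr_ae (hlim.mono fun x hx => hx.enorm.liminf_eq.symm)]
  exact (lintegral_liminf_le' fun n => (hF n).enorm).trans
    (liminf_le_of_frequently_le' (Frequently.of_forall hle))

/-- Two curves of probability densities which, to first order, follow the same Markov operators
up to a drift `-d` of the second one, with uniform bounds. -/
structure IsEntropyFlow {Ω : Type*} [MeasurableSpace Ω] (ν : Measure Ω) (T c Q : ℝ)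
    (r s d : ℝ → Lp ℝ 1 ν) : Prop where
  pos : 0 < c
  nonneg : 0 ≤ Q
  cont_fst : ContinuousOn r (Icc 0 T)
  cont_snd : ContinuousOn s (Icc 0 T)
  cont_drift : ContinuousOn d (Icc 0 T)
  fst_nonneg : ∀ t ∈ Icc 0 T, ∀ᵐ x ∂ν, 0 ≤ r t x
  le_snd : ∀ t ∈ Icc 0 T, ∀ᵐ x ∂ν, c ≤ s t x
  drift_le : ∀ t ∈ Icc 0 T, ∀ᵐ x ∂ν, |d t x| ≤ Q
  mass_fst : ∀ t ∈ Icc 0 T, ∫ x, r t x ∂ν = 1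
  mass_snd : ∀ t ∈ Icc 0 T, ∫ x, s t x ∂ν = 1
  step : ∀ a ∈ Ico 0 T, ∃ V : ℝ → Lp ℝ 1 ν →L[ℝ] Lp ℝ 1 ν, (∀ h, 0 < h → IsMarkovOp ν (V h)) ∧
    Tendsto (fun t => (t - a)⁻¹ • (r t - V (t - a) (r a))) (𝓝[>] a) (𝓝 0) ∧
    Tendsto (fun t => (t - a)⁻¹ • (V (t - a) (s a) - s t)) (𝓝[>] a) (𝓝 (d a))

namespace IsEntropyFlow

variable {Ω : Type*} [MeasurableSpace Ω] {ν : Measure Ω} {T c Q : ℝ} {r s d : ℝ → Lp ℝ 1 ν}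

theorem snd_pos (H : IsEntropyFlow ν T c Q r s d) {t : ℝ} (ht : t ∈ Icc 0 T) :
    ∀ᵐ x ∂ν, 0 < s t x :=
  (H.le_snd t ht).mono fun _ h => H.pos.trans_le h

theorem continuousOn_truncEntropy (H : IsEntropyFlow ν T c Q r s d) {m : ℝ} (hm : 1 ≤ m) :
    ContinuousOn (fun t => ∫ x, truncEntropy m (r t x) (s t x) ∂ν) (Icc 0 T) := by
  refine continuousOn_integral_of_lipschitz H.cont_fst H.cont_snd H.cont_drift
    (fun t _ => integrable_truncEntropy hm (r t) (s t)) (C := Real.log m + 1 + m) ?_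
  intro t ht t' ht'
  filter_upwards [H.snd_pos ht, H.snd_pos ht'] with x h1 h2
  refine (abs_truncEntropy_sub_le hm h1 h2).trans ?_
  have h3 := Real.log_nonneg hm
  have h4 := abs_nonneg (r t x - r t' x)
  have h5 := abs_nonneg (s t x - s t' x)
  have h6 := abs_nonneg (d t x - d t' x)
  nlinarith [mul_nonneg h3 h5, mul_nonneg h3 h6,
    mul_nonneg (zero_le_one.trans hm) h4, mul_nonneg (zero_le_one.trans hm) h6]

theorem continuousOn_truncDrift (H : IsEntropyFlow ν T c Q r s d) {m : ℝ} (hm : 1 ≤ m) :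
    ContinuousOn (fun t => ∫ x, truncRatio m (r t x / s t x) * d t x ∂ν) (Icc 0 T) := by
  have hc := H.pos
  have hQ := H.nonneg
  have hm0 : 0 ≤ m := zero_le_one.trans hm
  refine continuousOn_integral_of_lipschitz H.cont_fst H.cont_snd H.cont_drift
    (fun t _ => integrable_truncRatio_mul hm (r t) (s t) (L1.integrable_coeFn (d t)))
    -- The term `m` comes from varying the drift, and `Q * (c⁻¹ * m)` from varying the truncated
    -- ratio against a drift bounded by `Q`.
    (C := m + Q * (c⁻¹ * m)) ?_
  intro t ht t' ht'
  filter_upwards [H.le_snd t ht, H.le_snd t' ht', H.drift_le t' ht'] with x h1 h2 h3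
  have h4 := abs_truncRatio_sub_le (r := r t x) (r' := r t' x) hm hc h1 h2
  have e : truncRatio m (r t x / s t x) * d t x - truncRatio m (r t' x / s t' x) * d t' x
      = truncRatio m (r t x / s t x) * (d t x - d t' x)
        + d t' x * (truncRatio m (r t x / s t x) - truncRatio m (r t' x / s t' x)) := by ring
  rw [e]
  refine (abs_add_le _ _).trans ?_
  rw [abs_mul, abs_mul, abs_of_pos (truncRatio_pos hm _)]
  have h5 := abs_nonneg (r t x - r t' x)
  have h6 := abs_nonneg (s t x - s t' x)
  have h7 := abs_nonneg (d t x - d t' x)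
  have h8 : |d t' x| * |truncRatio m (r t x / s t x) - truncRatio m (r t' x / s t' x)|
      ≤ Q * (c⁻¹ * (m * |r t x - r t' x| + m * |s t x - s t' x|)) := by
    refine mul_le_mul h3 (h4.trans ?_) (abs_nonneg _) hQ
    gcongr
    exact le_mul_of_one_le_left h5 hm
  have h9 : truncRatio m (r t x / s t x) * |d t x - d t' x| ≤ m * |d t x - d t' x| := by
    gcongr
    exact truncRatio_le hm _
  have h10 : 0 ≤ Q * (c⁻¹ * m) := by positivity
  nlinarith [mul_nonneg h10 h7, mul_nonneg hm0 h5, mul_nonneg hm0 h6]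

/-- Both curves are compared with the same `V`, so data processing leaves only the `o(t - a)` error
of `r` and the drift of `s`. -/
theorem truncEntropy_le (H : IsEntropyFlow ν T c Q r s d) {m : ℝ} (hm : 1 ≤ m) {a b : ℝ}
    (ha : 0 ≤ a) (hab : a ≤ b) (hb : b ≤ T) :
    ∫ x, truncEntropy m (r b x) (s b x) ∂ν ≤ ∫ x, truncEntropy m (r a x) (s a x) ∂ν
      + ∫ t in a..b, ∫ x, truncRatio m (r t x / s t x) * d t x ∂ν := by
  refine le_add_integral_of_slope (H.continuousOn_truncEntropy hm) (H.continuousOn_truncDrift hm)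
    ?_ ha hab hb
  intro a ha
  obtain ⟨V, hV, hVr, hVs⟩ := H.step a ha
  have hmem : Icc 0 T ∈ 𝓝[>] a := mem_of_superset (Ioo_mem_nhdsGT ha.2)
    fun y hy => ⟨ha.1.trans hy.1.le, hy.2.le⟩
  have hd : Tendsto d (𝓝[>] a) (𝓝 (d a)) :=
    (H.cont_drift a ⟨ha.1, ha.2.le⟩).mono_of_mem_nhdsWithin hmem
  refine ⟨fun t => (Real.log m + 1) * ‖(t - a)⁻¹ • (r t - V (t - a) (r a))‖
    + m * ‖(t - a)⁻¹ • (V (t - a) (s a) - s t) - d t‖, ?_, ?_⟩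
  · have := (hVr.norm.const_mul (Real.log m + 1)).add ((hVs.sub hd).norm.const_mul m)
    simpa using this
  filter_upwards [self_mem_nhdsWithin] with t ht
  have hts : 0 < t - a := sub_pos.2 (mem_Ioi.1 ht)
  have h1 := (hV _ hts).integral_truncEntropy_le hm (r a) (s a) (r t) (s t)
    (H.snd_pos ⟨ha.1, ha.2.le⟩)
  set w : Lp ℝ 1 ν := (t - a)⁻¹ • (V (t - a) (s a) - s t) - d t with hw
  have e : V (t - a) (s a) - s t = (t - a) • (d t + w) := by
    rw [hw, add_sub_cancel, smul_smul, mul_inv_cancel₀ hts.ne', one_smul]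
  have hid := integrable_truncRatio_mul hm (r t) (s t) (L1.integrable_coeFn (d t))
  have hiw := integrable_truncRatio_mul hm (r t) (s t) (L1.integrable_coeFn w)
  have h2 : ∫ x, truncRatio m (r t x / s t x) * (V (t - a) (s a) - s t : Lp ℝ 1 ν) x ∂ν
      = (t - a) * (∫ x, truncRatio m (r t x / s t x) * d t x ∂ν
        + ∫ x, truncRatio m (r t x / s t x) * w x ∂ν) := by
    rw [← integral_add hid hiw, ← integral_const_mul, e]
    refine integral_congr_ae ?_
    filter_upwards [Lp.coeFn_smul (t - a) (d t + w), Lp.coeFn_add (d t) w] with x h3 h4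
    rw [h3, Pi.smul_apply, h4, Pi.add_apply, smul_eq_mul]
    ring
  have h3 : ∫ x, truncRatio m (r t x / s t x) * w x ∂ν ≤ m * ‖w‖ := by
    rw [L1.norm_eq_integral_norm, ← integral_const_mul]
    refine integral_mono hiw ((L1.integrable_coeFn w).norm.const_mul m) fun x => ?_
    refine (le_abs_self _).trans ?_
    rw [abs_mul, abs_of_pos (truncRatio_pos hm _)]
    exact mul_le_mul_of_nonneg_right (truncRatio_le hm _) (abs_nonneg _)
  have h4 : ‖r t - V (t - a) (r a)‖ = (t - a) * ‖(t - a)⁻¹ • (r t - V (t - a) (r a))‖ := by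
    rw [norm_smul, norm_inv, Real.norm_eq_abs, abs_of_pos hts, mul_inv_cancel_left₀ hts.ne']
  rw [h2, h4] at h1
  nlinarith

theorem integrable_ratio_mul (H : IsEntropyFlow ν T c Q r s d) {t : ℝ} (ht : t ∈ Icc 0 T) :
    Integrable (fun x => r t x / s t x * d t x) ν := by
  refine ((L1.integrable_coeFn (r t)).const_mul (c⁻¹ * Q)).mono'
    (((Lp_measurable _).div (Lp_measurable _)).mul (Lp_measurable _)).aestronglyMeasurable ?_
  filter_upwards [H.fst_nonneg t ht, H.le_snd t ht, H.drift_le t ht] with x h1 h2 h3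
  have hc := H.pos
  rw [Real.norm_eq_abs, abs_mul, abs_of_nonneg (div_nonneg h1 (hc.le.trans h2))]
  calc r t x / s t x * |d t x| ≤ r t x / c * Q := by
        have := H.nonneg
        gcongr
    _ = c⁻¹ * Q * r t x := by ring

/-- The bound does not depend on `m`, since the truncated ratio is at most `r / c + 1`. Its integral
is also independent of time because `r` has mass one, which justifies both dominated limits. -/
theorem norm_truncDrift_le [IsFiniteMeasure ν] (H : IsEntropyFlow ν T c Q r s d) {m : ℝ}
    (hm : 1 ≤ m) {t : ℝ} (ht : t ∈ Icc 0 T) :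
    ∀ᵐ x ∂ν, ‖truncRatio m (r t x / s t x) * d t x‖ ≤ c⁻¹ * Q * r t x + Q := by
  filter_upwards [H.fst_nonneg t ht, H.le_snd t ht, H.drift_le t ht] with x h1 h2 h3
  have hc := H.pos
  rw [Real.norm_eq_abs, abs_mul, abs_of_pos (truncRatio_pos hm _)]
  calc truncRatio m (r t x / s t x) * |d t x| ≤ (r t x / c + 1) * Q := by
        refine mul_le_mul ((truncRatio_le_add_one hm (div_nonneg h1 (hc.le.trans h2))).trans ?_)
          h3 (abs_nonneg _) (by positivity)
        gcongr
    _ = c⁻¹ * Q * r t x + Q := by ring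

theorem integrable_truncDrift_bound [IsFiniteMeasure ν] (f : Lp ℝ 1 ν) (c Q : ℝ) :
    Integrable (fun x => c⁻¹ * Q * f x + Q) ν :=
  ((L1.integrable_coeFn f).const_mul _).add (integrable_const Q)

theorem abs_integral_truncDrift_le [IsFiniteMeasure ν] (H : IsEntropyFlow ν T c Q r s d) {m : ℝ}
    (hm : 1 ≤ m) {t : ℝ} (ht : t ∈ Icc 0 T) :
    ‖∫ x, truncRatio m (r t x / s t x) * d t x ∂ν‖ ≤ c⁻¹ * Q + Q * ν.real univ := by
  refine (norm_integral_le_of_norm_le (integrable_truncDrift_bound (r t) c Q)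
    (H.norm_truncDrift_le hm ht)).trans_eq ?_
  rw [integral_add ((L1.integrable_coeFn _).const_mul _) (integrable_const _), integral_const_mul,
    H.mass_fst t ht, integral_const, smul_eq_mul]
  ring

theorem one_le_natCast_add_one (n : ℕ) : (1 : ℝ) ≤ (n : ℝ) + 1 := by
  have : (0 : ℝ) ≤ n := n.cast_nonneg
  linarith

theorem tendsto_truncDrift [IsFiniteMeasure ν] (H : IsEntropyFlow ν T c Q r s d) {t : ℝ}
    (ht : t ∈ Icc 0 T) :
    Tendsto (fun n : ℕ => ∫ x, truncRatio ((n : ℝ) + 1) (r t x / s t x) * d t x ∂ν) atTop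
      (𝓝 (∫ x, r t x / s t x * d t x ∂ν)) := by
  refine tendsto_integral_of_dominated_convergence _
    (fun n => (integrable_truncRatio_mul (one_le_natCast_add_one n) (r t) (s t)
      (L1.integrable_coeFn (d t))).aestronglyMeasurable)
    (integrable_truncDrift_bound (r t) c Q)
    (fun n => H.norm_truncDrift_le (one_le_natCast_add_one n) ht) ?_
  filter_upwards [H.fst_nonneg t ht, H.snd_pos ht] with x h1 h2
  exact (tendsto_truncRatio (div_nonneg h1 h2.le)).mul_const _

/-- Measurability in time is inherited from the truncated drifts, which are continuous and converge
pointwise. -/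
theorem intervalIntegrable_drift [IsFiniteMeasure ν] (H : IsEntropyFlow ν T c Q r s d) {a b : ℝ}
    (ha : 0 ≤ a) (hab : a ≤ b) (hb : b ≤ T) :
    IntervalIntegrable (fun t => ∫ x, r t x / s t x * d t x ∂ν) volume a b := by
  have hsub : Ioc a b ⊆ Icc 0 T := fun x hx => ⟨ha.trans hx.1.le, hx.2.trans hb⟩
  rw [intervalIntegrable_iff_integrableOn_Ioc_of_le hab]
  refine (integrable_const (c⁻¹ * Q + Q * ν.real univ)).mono' ?_ ?_
  · refine aestronglyMeasurable_of_tendsto_ae atTop (f := fun (n : ℕ) t =>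
      ∫ x, truncRatio ((n : ℝ) + 1) (r t x / s t x) * d t x ∂ν) (fun n => ?_) ?_
    · exact ((H.continuousOn_truncDrift (one_le_natCast_add_one n)).mono
        hsub).aestronglyMeasurable measurableSet_Ioc
    · filter_upwards [ae_restrict_mem measurableSet_Ioc] with t ht
      exact H.tendsto_truncDrift (hsub ht)
  · filter_upwards [ae_restrict_mem measurableSet_Ioc] with t ht
    exact le_of_tendsto (H.tendsto_truncDrift (hsub ht)).norm (Eventually.of_forall fun n =>
      H.abs_integral_truncDrift_le (one_le_natCast_add_one n) (hsub ht))

theorem tendsto_integral_truncDrift [IsFiniteMeasure ν] (H : IsEntropyFlow ν T c Q r s d) {a b : ℝ}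
    (ha : 0 ≤ a) (hab : a ≤ b) (hb : b ≤ T) :
    Tendsto (fun n : ℕ => ∫ t in a..b,
        ∫ x, truncRatio ((n : ℝ) + 1) (r t x / s t x) * d t x ∂ν) atTop
      (𝓝 (∫ t in a..b, ∫ x, r t x / s t x * d t x ∂ν)) := by
  have hsub : Ioc a b ⊆ Icc 0 T := fun x hx => ⟨ha.trans hx.1.le, hx.2.trans hb⟩
  refine intervalIntegral.tendsto_integral_filter_of_dominated_convergence
    (fun _ => c⁻¹ * Q + Q * ν.real univ) (Eventually.of_forall fun n => ?_)
    (Eventually.of_forall fun n => Eventually.of_forall fun t ht => ?_)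
    intervalIntegrable_const (Eventually.of_forall fun t ht => ?_)
  · rw [uIoc_of_le hab]
    exact ((H.continuousOn_truncDrift (one_le_natCast_add_one n)).mono
        hsub).aestronglyMeasurable measurableSet_Ioc
  · rw [uIoc_of_le hab] at ht
    exact H.abs_integral_truncDrift_le (one_le_natCast_add_one n) (hsub ht)
  · rw [uIoc_of_le hab] at ht
    exact H.tendsto_truncDrift (hsub ht)

theorem integral_truncEntropy_le (H : IsEntropyFlow ν T c Q r s d) {m : ℝ} (hm : 1 ≤ m) {t : ℝ}
    (ht : t ∈ Icc 0 T) (hi : Integrable (fun x => r t x * Real.log (r t x / s t x)) ν) :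
    ∫ x, truncEntropy m (r t x) (s t x) ∂ν ≤ relEntropy ν (r t) (s t) := by
  refine integral_mono_ae (integrable_truncEntropy hm _ _) hi ?_
  filter_upwards [H.fst_nonneg t ht, H.snd_pos ht] with x h1 h2
  exact _root_.truncEntropy_le hm h1 h2

theorem tendsto_truncEntropy (H : IsEntropyFlow ν T c Q r s d) {t : ℝ}
    (ht : t ∈ Icc 0 T) (hi : Integrable (fun x => r t x * Real.log (r t x / s t x)) ν) :
    Tendsto (fun n : ℕ => ∫ x, truncEntropy ((n : ℝ) + 1) (r t x) (s t x) ∂ν) atTop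
      (𝓝 (relEntropy ν (r t) (s t))) := by
  refine tendsto_integral_of_dominated_convergence
    (fun x => |r t x * Real.log (r t x / s t x)| + |r t x - s t x|)
    (fun n => (measurable_truncEntropy _ _ _).aestronglyMeasurable)
    (hi.abs.add ((L1.integrable_coeFn _).sub (L1.integrable_coeFn _)).abs) (fun n => ?_) ?_
  · filter_upwards [H.fst_nonneg t ht, H.snd_pos ht] with x h1 h2
    have h3 := _root_.truncEntropy_le (one_le_natCast_add_one n) h1 h2
    have h4 := sub_le_truncEntropy (one_le_natCast_add_one n) (r := r t x) h2
    rw [Real.norm_eq_abs, abs_le]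
    constructor
    · linarith [neg_abs_le (r t x - s t x), abs_nonneg (r t x * Real.log (r t x / s t x))]
    · linarith [abs_nonneg (r t x - s t x), le_abs_self (r t x * Real.log (r t x / s t x))]
  · filter_upwards [H.fst_nonneg t ht, H.snd_pos ht] with x h1 h2
    exact _root_.tendsto_truncEntropy h1 h2

/-- Fatou's lemma for the nonnegative functions `truncEntropy - (r - s)`: the masses cancel, so
their integrals are bounded uniformly in `n` by the initial entropy plus the drift bound. -/
theorem integrable_entropy [IsFiniteMeasure ν] (H : IsEntropyFlow ν T c Q r s d)
    (hi : Integrable (fun x => r 0 x * Real.log (r 0 x / s 0 x)) ν) {t : ℝ} (ht : t ∈ Icc 0 T) :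
    Integrable (fun x => r t x * Real.log (r t x / s t x)) ν := by
  have hsub : Integrable (fun x => r t x - s t x) ν :=
    (L1.integrable_coeFn _).sub (L1.integrable_coeFn _)
  have h0 : (0 : ℝ) ∈ Icc 0 T := ⟨le_rfl, ht.1.trans ht.2⟩
  have hint : ∀ n : ℕ, Integrable
      (fun x => truncEntropy ((n : ℝ) + 1) (r t x) (s t x) - (r t x - s t x)) ν := fun n =>
    (integrable_truncEntropy (one_le_natCast_add_one n) _ _).sub hsub
  set C := relEntropy ν (r 0) (s 0) + (c⁻¹ * Q + Q * ν.real univ) * |t - 0| with hC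
  have hbound : ∀ n : ℕ, ∫⁻ x, ‖truncEntropy ((n : ℝ) + 1) (r t x) (s t x) - (r t x - s t x)‖ₑ ∂ν
      ≤ ENNReal.ofReal C := by
    intro n
    have hm := one_le_natCast_add_one n
    rw [← ofReal_integral_norm_eq_lintegral_enorm (hint n)]
    refine ENNReal.ofReal_le_ofReal ?_
    have e : ∫ x, ‖truncEntropy ((n : ℝ) + 1) (r t x) (s t x) - (r t x - s t x)‖ ∂ν
        = ∫ x, truncEntropy ((n : ℝ) + 1) (r t x) (s t x) - (r t x - s t x) ∂ν := by
      refine integral_congr_ae ?_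
      filter_upwards [H.snd_pos ht] with x h2
      exact abs_of_nonneg (sub_nonneg.2 (sub_le_truncEntropy hm h2))
    rw [e, integral_sub (integrable_truncEntropy hm _ _) hsub,
      integral_sub (L1.integrable_coeFn _) (L1.integrable_coeFn _), H.mass_fst t ht,
      H.mass_snd t ht, sub_self, sub_zero]
    refine (H.truncEntropy_le hm le_rfl ht.1 ht.2).trans
      (add_le_add (H.integral_truncEntropy_le hm h0 hi) ((le_abs_self _).trans ?_))
    rw [← Real.norm_eq_abs]
    refine intervalIntegral.norm_integral_le_of_norm_le_const fun x hx => ?_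
    rw [uIoc_of_le ht.1] at hx
    exact H.abs_integral_truncDrift_le hm ⟨hx.1.le, hx.2.trans ht.2⟩
  have hlim : ∀ᵐ x ∂ν, Tendsto (fun n : ℕ => truncEntropy ((n : ℝ) + 1) (r t x) (s t x)
      - (r t x - s t x)) atTop (𝓝 (r t x * Real.log (r t x / s t x) - (r t x - s t x))) := by
    filter_upwards [H.fst_nonneg t ht, H.snd_pos ht] with x h1 h2
    exact (_root_.tendsto_truncEntropy h1 h2).sub_const _
  have := integrable_of_tendsto_of_lintegral_le hlim (fun n => (hint n).aestronglyMeasurable)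
    ENNReal.ofReal_ne_top hbound
  refine (this.add hsub).congr (Eventually.of_forall fun x => ?_)
  simp

theorem relEntropy_le [IsFiniteMeasure ν] (H : IsEntropyFlow ν T c Q r s d)
    (hi : Integrable (fun x => r 0 x * Real.log (r 0 x / s 0 x)) ν) {a b : ℝ}
    (ha : 0 ≤ a) (hab : a ≤ b) (hb : b ≤ T) :
    relEntropy ν (r b) (s b) ≤ relEntropy ν (r a) (s a)
      + ∫ t in a..b, ∫ x, r t x / s t x * d t x ∂ν := by
  have ha' : a ∈ Icc 0 T := ⟨ha, hab.trans hb⟩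
  have hb' : b ∈ Icc 0 T := ⟨ha.trans hab, hb⟩
  exact le_of_tendsto_of_tendsto (H.tendsto_truncEntropy hb' (H.integrable_entropy hi hb'))
    ((H.tendsto_truncEntropy ha' (H.integrable_entropy hi ha')).add
      (H.tendsto_integral_truncDrift ha hab hb))
    (Eventually.of_forall fun n => H.truncEntropy_le (one_le_natCast_add_one n) ha hab hb)

/-- The entropy minus the primitive of the drift is nonincreasing, by `relEntropy_le` on
subintervals. So the entropy is a monotone function plus a continuous one. -/
theorem intervalIntegrable_relEntropy [IsFiniteMeasure ν] (H : IsEntropyFlow ν T c Q r s d)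
    (hi : Integrable (fun x => r 0 x * Real.log (r 0 x / s 0 x)) ν) {t : ℝ} (ht : t ∈ Icc 0 T) :
    IntervalIntegrable (fun t => relEntropy ν (r t) (s t)) volume 0 t := by
  set G : ℝ → ℝ := fun t => ∫ x, r t x / s t x * d t x ∂ν with hG
  have hGi : ∀ a b, 0 ≤ a → a ≤ b → b ≤ T → IntervalIntegrable G volume a b := fun a b ha hab hb =>
    H.intervalIntegrable_drift ha hab hb
  have h1 : AntitoneOn (fun u => relEntropy ν (r u) (s u) - ∫ v in (0 : ℝ)..u, G v) (uIcc 0 t) := by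
    intro a ha b hb hab
    rw [uIcc_of_le ht.1] at ha hb
    have h2 := H.relEntropy_le hi ha.1 hab (hb.2.trans ht.2)
    have h3 := intervalIntegral.integral_add_adjacent_intervals
      (hGi 0 a le_rfl ha.1 (ha.2.trans ht.2)) (hGi a b ha.1 hab (hb.2.trans ht.2))
    dsimp only
    rw [← h3]
    linarith
  have h2 : ContinuousOn (fun u => ∫ v in (0 : ℝ)..u, G v) (uIcc 0 t) := by
    refine intervalIntegral.continuousOn_primitive_interval ?_
    rw [uIcc_of_le ht.1, integrableOn_Icc_iff_integrableOn_Ioc]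
    exact (intervalIntegrable_iff_integrableOn_Ioc_of_le ht.1).1 (hGi 0 t le_rfl ht.1 ht.2)
  refine (h1.intervalIntegrable.add h2.intervalIntegrable).congr fun u _ => ?_
  simp

end IsEntropyFlow

/-! ### The exponential moment of the drift -/

theorem abs_exp_sub_exp_le {a b M : ℝ} (ha : a ≤ M) (hb : b ≤ M) :
    |Real.exp a - Real.exp b| ≤ Real.exp M * |a - b| := by
  wlog h : b ≤ a generalizing a b
  · rw [abs_sub_comm, abs_sub_comm a]
    exact this hb ha (le_of_not_ge h)
  rw [abs_of_nonneg (sub_nonneg.2 (Real.exp_le_exp.2 h)), abs_of_nonneg (sub_nonneg.2 h)]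
  have h1 : Real.exp b = Real.exp a * Real.exp (b - a) := by rw [← Real.exp_add]; congr 1; ring
  calc Real.exp a - Real.exp b = Real.exp a * (1 - Real.exp (b - a)) := by rw [h1]; ring
    _ ≤ Real.exp a * (a - b) := by
        refine mul_le_mul_of_nonneg_left ?_ (Real.exp_pos a).le
        linarith [Real.add_one_le_exp (b - a)]
    _ ≤ Real.exp M * (a - b) := by
        have := sub_nonneg.2 h
        gcongr

namespace IsEntropyFlow

variable {Ω : Type*} [MeasurableSpace Ω] {ν : Measure Ω} {T c Q : ℝ} {r s d : ℝ → Lp ℝ 1 ν}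

theorem abs_exponent_le (H : IsEntropyFlow ν T c Q r s d) {η : ℝ} (hη : 0 < η) {t : ℝ}
    (ht : t ∈ Icc 0 T) : ∀ᵐ x ∂ν, |η⁻¹ * (d t x / s t x)| ≤ η⁻¹ * (Q / c) := by
  filter_upwards [H.le_snd t ht, H.drift_le t ht] with x h1 h2
  have hc := H.pos
  have hQ := H.nonneg
  rw [abs_mul, abs_of_pos (inv_pos.2 hη), abs_div, abs_of_pos (hc.trans_le h1)]
  gcongr

theorem integrable_exp_drift (H : IsEntropyFlow ν T c Q r s d) {η : ℝ} (hη : 0 < η) {t : ℝ}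
    (ht : t ∈ Icc 0 T) :
    Integrable (fun x => Real.exp (η⁻¹ * (d t x / s t x)) * s t x) ν := by
  refine (L1.integrable_coeFn (s t)).bdd_mul (c := Real.exp (η⁻¹ * (Q / c)))
    (Real.measurable_exp.comp (((Lp_measurable _).div
      (Lp_measurable _)).const_mul _)).aestronglyMeasurable ?_
  filter_upwards [H.abs_exponent_le hη ht] with x h1
  rw [Real.norm_eq_abs, Real.abs_exp]
  exact Real.exp_le_exp.2 ((le_abs_self _).trans h1)

theorem integral_exp_drift_pos (H : IsEntropyFlow ν T c Q r s d) {η : ℝ} (hη : 0 < η) {t : ℝ}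
    (ht : t ∈ Icc 0 T) : 0 < ∫ x, Real.exp (η⁻¹ * (d t x / s t x)) * s t x ∂ν := by
  have h : ∫ x, Real.exp (-(η⁻¹ * (Q / c))) * s t x ∂ν
      ≤ ∫ x, Real.exp (η⁻¹ * (d t x / s t x)) * s t x ∂ν := by
    refine integral_mono_ae ((L1.integrable_coeFn _).const_mul _) (H.integrable_exp_drift hη ht) ?_
    filter_upwards [H.abs_exponent_le hη ht, H.snd_pos ht] with x h1 h2
    have := (abs_le.1 h1).1
    gcongr
  rw [integral_const_mul, H.mass_snd t ht, mul_one] at h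
  exact (Real.exp_pos _).trans_le h

theorem continuousOn_exp_drift (H : IsEntropyFlow ν T c Q r s d) {η : ℝ} (hη : 0 < η) :
    ContinuousOn (fun t => ∫ x, Real.exp (η⁻¹ * (d t x / s t x)) * s t x ∂ν) (Icc 0 T) := by
  have hc := H.pos
  have hQ := H.nonneg
  set E := Real.exp (η⁻¹ * (Q / c)) with hE
  have hE0 : 0 < E := Real.exp_pos _
  refine continuousOn_integral_of_lipschitz H.cont_fst H.cont_snd H.cont_drift
    (fun t ht => H.integrable_exp_drift hη ht) (C := E * η⁻¹ + (E * (η⁻¹ * (Q / c)) + E)) ?_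
  intro t ht t' ht'
  filter_upwards [H.abs_exponent_le hη ht, H.abs_exponent_le hη ht', H.snd_pos ht, H.snd_pos ht']
    with x h1 h2 h3 h4
  set q := η⁻¹ * (d t x / s t x) with hq
  set q' := η⁻¹ * (d t' x / s t' x) with hq'
  have e1 : q * s t x = η⁻¹ * d t x := by rw [hq]; field_simp
  have e2 : q' * s t' x = η⁻¹ * d t' x := by rw [hq']; field_simp
  -- Keeping the weight `s t x` and using `q * s = η⁻¹ * d` avoids any upper bound on `s`, which the
  -- structure does not provide.
  have h5 : |q - q'| * s t x ≤ η⁻¹ * |d t x - d t' x| + η⁻¹ * (Q / c) * |s t x - s t' x| := by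
    have e3 : (q - q') * s t x = η⁻¹ * (d t x - d t' x) + -(q' * (s t x - s t' x)) := by
      linear_combination e1 - e2
    calc |q - q'| * s t x = |(q - q') * s t x| := by rw [abs_mul, abs_of_pos h3]
      _ ≤ |η⁻¹ * (d t x - d t' x)| + |-(q' * (s t x - s t' x))| := by
          rw [e3]; exact abs_add_le _ _
      _ ≤ _ := by
          rw [abs_neg, abs_mul, abs_mul, abs_of_pos (inv_pos.2 hη)]
          gcongr
  have h6 := abs_exp_sub_exp_le ((le_abs_self _).trans h1) ((le_abs_self _).trans h2)
  have h7 : Real.exp q' ≤ E := Real.exp_le_exp.2 ((le_abs_self _).trans h2)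
  have e4 : Real.exp q * s t x - Real.exp q' * s t' x
      = (Real.exp q - Real.exp q') * s t x + Real.exp q' * (s t x - s t' x) := by ring
  have a1 := abs_nonneg (r t x - r t' x)
  have a2 := abs_nonneg (s t x - s t' x)
  have a3 := abs_nonneg (d t x - d t' x)
  have p1 : 0 ≤ E * η⁻¹ := by positivity
  have p2 : 0 ≤ E * (η⁻¹ * (Q / c)) := by positivity
  calc |Real.exp q * s t x - Real.exp q' * s t' x|
      ≤ |Real.exp q - Real.exp q'| * s t x + Real.exp q' * |s t x - s t' x| := by
        rw [e4]
        refine (abs_add_le _ _).trans_eq ?_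
        rw [abs_mul, abs_mul, abs_of_pos h3, Real.abs_exp]
    _ ≤ E * |q - q'| * s t x + E * |s t x - s t' x| := by gcongr
    _ = E * (|q - q'| * s t x) + E * |s t x - s t' x| := by ring
    _ ≤ E * (η⁻¹ * |d t x - d t' x| + η⁻¹ * (Q / c) * |s t x - s t' x|)
          + E * |s t x - s t' x| := by gcongr
    _ ≤ _ := by
        nlinarith [mul_nonneg p1 a1, mul_nonneg p1 a2, mul_nonneg p2 a1, mul_nonneg p2 a3,
          mul_nonneg hE0.le a1, mul_nonneg hE0.le a3]

/-- The entropy inequality (Gibbs variational principle) applied to the drift. -/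
theorem integral_drift_le (H : IsEntropyFlow ν T c Q r s d) {η : ℝ} (hη : 0 < η) {t : ℝ}
    (ht : t ∈ Icc 0 T) (hi : Integrable (fun x => r t x * Real.log (r t x / s t x)) ν) :
    ∫ x, r t x / s t x * d t x ∂ν ≤ η * (relEntropy ν (r t) (s t)
      + Real.log (∫ x, Real.exp (η⁻¹ * (d t x / s t x)) * s t x ∂ν)) := by
  set Z := ∫ x, Real.exp (η⁻¹ * (d t x / s t x)) * s t x ∂ν with hZ
  have hZ0 : 0 < Z := H.integral_exp_drift_pos hη ht
  have i1 : Integrable (fun x => η⁻¹ * (r t x / s t x * d t x)) ν :=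
    (H.integrable_ratio_mul ht).const_mul _
  have i2 : Integrable (fun x => (1 - Real.log Z) * r t x) ν :=
    (L1.integrable_coeFn (r t)).const_mul _
  have i3 : Integrable (fun x => Z⁻¹ * (Real.exp (η⁻¹ * (d t x / s t x)) * s t x)) ν :=
    (H.integrable_exp_drift hη ht).const_mul _
  have i4 : Integrable (fun x => η⁻¹ * (r t x / s t x * d t x) + (1 - Real.log Z) * r t x) ν :=
    i1.add i2
  have h : ∫ x, (η⁻¹ * (r t x / s t x * d t x) + (1 - Real.log Z) * r t x
      - Z⁻¹ * (Real.exp (η⁻¹ * (d t x / s t x)) * s t x)) ∂ν ≤ relEntropy ν (r t) (s t) := by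
    refine integral_mono_ae (i4.sub i3) hi ?_
    filter_upwards [H.fst_nonneg t ht, H.snd_pos ht] with x h1 h2
    -- The optimal `a` is the density, relative to `σ`, of the exponentially tilted probability
    -- measure.
    have h3 := young_entropy (a := Real.exp (η⁻¹ * (d t x / s t x)) / Z)
      (div_pos (Real.exp_pos _) hZ0) h1 h2
    rw [Real.log_div (Real.exp_pos _).ne' hZ0.ne', Real.log_exp] at h3
    refine le_trans (le_of_eq ?_) h3
    rw [div_eq_inv_mul, div_eq_inv_mul, div_eq_inv_mul]
    ring
  rw [integral_sub i4 i3, integral_add i1 i2, integral_const_mul, integral_const_mul,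
    integral_const_mul, H.mass_fst t ht, ← hZ, inv_mul_cancel₀ hZ0.ne'] at h
  rw [← div_le_iff₀' hη, div_eq_inv_mul]
  linarith

theorem relEntropy_le_exp [IsFiniteMeasure ν] (H : IsEntropyFlow ν T c Q r s d)
    (hi : Integrable (fun x => r 0 x * Real.log (r 0 x / s 0 x)) ν) {η : ℝ} (hη : 0 < η) {t : ℝ}
    (ht : t ∈ Icc 0 T) :
    IntervalIntegrable (fun u => relEntropy ν (r u) (s u)
      + Real.log (∫ x, Real.exp (η⁻¹ * (d u x / s u x)) * s u x ∂ν)) volume 0 t ∧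
    relEntropy ν (r t) (s t) ≤ relEntropy ν (r 0) (s 0)
      + η * ∫ u in (0 : ℝ)..t, (relEntropy ν (r u) (s u)
        + Real.log (∫ x, Real.exp (η⁻¹ * (d u x / s u x)) * s u x ∂ν)) := by
  have hint : IntervalIntegrable (fun u => relEntropy ν (r u) (s u)
      + Real.log (∫ x, Real.exp (η⁻¹ * (d u x / s u x)) * s u x ∂ν)) volume 0 t := by
    refine (H.intervalIntegrable_relEntropy hi ht).add (ContinuousOn.intervalIntegrable ?_)
    rw [uIcc_of_le ht.1]
    have hsub : Icc 0 t ⊆ Icc 0 T := Icc_subset_Icc_right ht.2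
    exact ((H.continuousOn_exp_drift hη).mono hsub).log fun u hu =>
      (H.integral_exp_drift_pos hη (hsub hu)).ne'
  refine ⟨hint, (H.relEntropy_le hi le_rfl ht.1 ht.2).trans ?_⟩
  rw [← intervalIntegral.integral_const_mul]
  gcongr
  refine intervalIntegral.integral_mono_on ht.1 (H.intervalIntegrable_drift le_rfl ht.1 ht.2)
    (hint.const_mul η) fun u hu => ?_
  have hu' : u ∈ Icc 0 T := ⟨hu.1, hu.2.trans ht.2⟩
  exact H.integral_drift_le hη hu' (H.integrable_entropy hi hu')

end IsEntropyFlow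

/-! ### Mild solutions -/

section Mild

variable {Ω : Type*} [MeasurableSpace Ω] {ν : Measure Ω}

theorem IsBoundedAdjointMarkovGenerator.exists_semigroup {A : Lp ℝ 1 ν →L[ℝ] Lp ℝ 1 ν}
    (hA : IsBoundedAdjointMarkovGenerator ν A) :
    ∃ M : ℝ → Lp ℝ 1 ν →L[ℝ] Lp ℝ 1 ν, IsAdjointMarkovSemigroup ν M ∧
      ∀ f, Tendsto (fun h : ℝ => h⁻¹ • (M h f - f)) (𝓝[>] 0) (𝓝 (A f)) := by
  obtain ⟨M, hM, hgen⟩ := hA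
  refine ⟨M, hM, fun f => ?_⟩
  obtain ⟨h1, h2⟩ := LinearPMap.ext_iff.1 hgen
  have hf : f ∈ (infinitesimalGenerator M).domain := by rw [h1]; trivial
  have h3 := h2 (x := f) (hf := hf) (hg := trivial)
  have h4 := infinitesimalGenerator_spec M ⟨f, hf⟩
  rw [h3] at h4
  exact h4

/-- `M` need not be generated by the operator that drives `u`. With the driving generator the limit
is `0`; using the `M` of `A s` on the solution driven by `B` gives the drift `(A s - B s) (σ s)`. -/
theorem IsMildSolution.tendsto_step {S A : ℝ → Lp ℝ 1 ν →L[ℝ] Lp ℝ 1 ν} {T : ℝ} {u : ℝ → Lp ℝ 1 ν}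
    (hu : IsMildSolution ν S A T u) (hS : IsAdjointMarkovSemigroup ν S)
    (hA : ContinuousOn A (Icc 0 T)) {s : ℝ} (hs : s ∈ Ico 0 T) {M : ℝ → Lp ℝ 1 ν →L[ℝ] Lp ℝ 1 ν}
    {y : Lp ℝ 1 ν} (hM : Tendsto (fun h : ℝ => h⁻¹ • (M h (u s) - u s)) (𝓝[>] 0) (𝓝 y)) :
    Tendsto (fun t => (t - s)⁻¹ • (((S (t - s)).comp (M (t - s))) (u s) - u t)) (𝓝[>] s)
      (𝓝 (y - A s (u s))) := by
  have hc : ∀ t, 0 ≤ t → ∀ f, ‖S t f‖ ≤ ‖f‖ := fun t ht => (hS.isMarkovOp ht).norm_le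
  have h1 := (hS.toIsC0Semigroup.tendsto_comp hc hM).comp (tendsto_sub_nhdsGT_zero s)
  have h2 := hS.toIsC0Semigroup.tendsto_mild hc (hA.clm_apply hu.1) hu.2 hs
  refine (h1.sub h2).congr fun t => ?_
  rw [Function.comp_apply, ← smul_sub]
  congr 1
  abel

theorem Lp_const_smul_le_iff [IsFiniteMeasure ν] {c : ℝ} {f : Lp ℝ 1 ν} :
    c • Lp.const 1 ν (1 : ℝ) ≤ f ↔ ∀ᵐ x ∂ν, c ≤ f x := by
  rw [← Lp.coeFn_le]
  refine eventually_congr ?_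
  filter_upwards [Lp.coeFn_smul c (Lp.const 1 ν (1 : ℝ)), Lp.coeFn_const 1 ν (1 : ℝ)] with x h1 h2
  rw [h1, Pi.smul_apply, h2]
  simp

theorem Lp_le_const_smul_iff [IsFiniteMeasure ν] {c : ℝ} {f : Lp ℝ 1 ν} :
    f ≤ c • Lp.const 1 ν (1 : ℝ) ↔ ∀ᵐ x ∂ν, f x ≤ c := by
  rw [← Lp.coeFn_le]
  refine eventually_congr ?_
  filter_upwards [Lp.coeFn_smul c (Lp.const 1 ν (1 : ℝ)), Lp.coeFn_const 1 ν (1 : ℝ)] with x h1 h2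
  rw [h1, Pi.smul_apply, h2]
  simp

theorem ae_abs_le_of_eLpNorm_top_le {f : Ω → ℝ} {C : ℝ} (hC : 0 ≤ C)
    (h : eLpNorm f ∞ ν ≤ ENNReal.ofReal C) : ∀ᵐ x ∂ν, |f x| ≤ C := by
  rw [eLpNorm_exponent_top] at h
  filter_upwards [ae_le_eLpNormEssSup (f := f) (μ := ν)] with x hx
  have := hx.trans h
  rwa [Real.enorm_eq_ofReal_abs, ENNReal.ofReal_le_ofReal_iff hC] at this

theorem exists_ae_abs_le_of_memLp_top {f : Ω → ℝ} (hf : MemLp f ∞ ν) :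
    ∃ C, 0 ≤ C ∧ ∀ᵐ x ∂ν, |f x| ≤ C :=
  ⟨_, ENNReal.toReal_nonneg, ae_abs_le_of_eLpNorm_top_le ENNReal.toReal_nonneg
    (ENNReal.ofReal_toReal hf.2.ne).ge⟩

theorem UniformlyBoundedOnLinfty.exists_ae_abs_le {T : ℝ} {A : ℝ → Lp ℝ 1 ν →L[ℝ] Lp ℝ 1 ν}
    (hA : UniformlyBoundedOnLinfty ν T A) : ∃ C, 0 ≤ C ∧ ∀ t ∈ Icc 0 T, ∀ f : Lp ℝ 1 ν, ∀ D, 0 ≤ D →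
      (∀ᵐ x ∂ν, |f x| ≤ D) → ∀ᵐ x ∂ν, |A t f x| ≤ C * D := by
  obtain ⟨C, hC, h⟩ := hA
  refine ⟨C, hC, fun t ht f D hD hf => ae_abs_le_of_eLpNorm_top_le (by positivity) ?_⟩
  have h1 : eLpNorm f ∞ ν ≤ ENNReal.ofReal D := by
    rw [eLpNorm_exponent_top]
    exact eLpNormEssSup_le_of_ae_bound hf
  refine (h t ht f ⟨Lp.aestronglyMeasurable f, h1.trans_lt ENNReal.ofReal_lt_top⟩).trans ?_
  rw [ENNReal.ofReal_mul hC]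
  gcongr

/-- One step of the Markov evolution of a mild solution, and its effect on constants. -/
theorem IsMildSolution.exists_markov_step [IsFiniteMeasure ν]
    {S A : ℝ → Lp ℝ 1 ν →L[ℝ] Lp ℝ 1 ν} {T : ℝ} {u : ℝ → Lp ℝ 1 ν}
    (hu : IsMildSolution ν S A T u) (hS : IsAdjointMarkovSemigroup ν S)
    (hA : ∀ t ∈ Icc 0 T, IsBoundedAdjointMarkovGenerator ν (A t))
    (hAcont : ContinuousOn A (Icc 0 T)) (hAinf : UniformlyBoundedOnLinfty ν T A)
    {k : Lp ℝ 1 ν} (hk : MemLp k ∞ ν)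
    (hSk : Tendsto (fun h : ℝ => h⁻¹ • (S h (Lp.const 1 ν (1 : ℝ)) - Lp.const 1 ν (1 : ℝ)))
      (𝓝[>] 0) (𝓝 k)) :
    ∃ κ : ℝ, ∀ s ∈ Ico 0 T,
      ∃ V : ℝ → Lp ℝ 1 ν →L[ℝ] Lp ℝ 1 ν, (∀ h, 0 < h → IsMarkovOp ν (V h)) ∧
      Tendsto (fun t => (t - s)⁻¹ • (u t - V (t - s) (u s))) (𝓝[>] s) (𝓝 0) ∧
      ∃ k : Lp ℝ 1 ν, -(κ • Lp.const 1 ν (1 : ℝ)) ≤ k ∧ k ≤ κ • Lp.const 1 ν (1 : ℝ) ∧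
        Tendsto (fun h : ℝ => h⁻¹ • (V h (Lp.const 1 ν (1 : ℝ)) - Lp.const 1 ν (1 : ℝ)))
          (𝓝[>] 0) (𝓝 k) := by
  obtain ⟨C₁, -, hk⟩ := exists_ae_abs_le_of_memLp_top hk
  obtain ⟨C₂, -, hAC⟩ := hAinf.exists_ae_abs_le
  -- `C₁` bounds `k`, the derivative of `S h 1` at `h = 0`, and `C₂` bounds `A s 1` uniformly in
  -- `s`; the derivative of `S h (M h 1)` is their sum `k + A s 1`.
  refine ⟨C₁ + C₂, fun s hs => ?_⟩
  have hs' : s ∈ Icc 0 T := ⟨hs.1, hs.2.le⟩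
  obtain ⟨M, hM, hgen⟩ := (hA s hs').exists_semigroup
  have hc : ∀ t, 0 ≤ t → ∀ f, ‖S t f‖ ≤ ‖f‖ := fun t ht => (hS.isMarkovOp ht).norm_le
  have hA1 : ∀ᵐ x ∂ν, |A s (Lp.const 1 ν (1 : ℝ)) x| ≤ C₂ := by
    have := hAC s hs' (Lp.const 1 ν (1 : ℝ)) 1 zero_le_one (by
      filter_upwards [Lp.coeFn_const 1 ν (1 : ℝ)] with x hx
      rw [hx]; simp)
    simpa using this
  have hb : ∀ᵐ x ∂ν, |(k + A s (Lp.const 1 ν (1 : ℝ)) : Lp ℝ 1 ν) x| ≤ C₁ + C₂ := by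
    filter_upwards [hk, hA1, Lp.coeFn_add k (A s (Lp.const 1 ν (1 : ℝ)))] with x h1 h2 h3
    rw [h3]
    exact (abs_add_le _ _).trans (add_le_add h1 h2)
  refine ⟨fun h => (S h).comp (M h), fun h hh => (hS.isMarkovOp hh.le).comp (hM.isMarkovOp hh.le),
    ?_, k + A s (Lp.const 1 ν (1 : ℝ)), ?_, ?_, ?_⟩
  · have := (hu.tendsto_step hS hAcont hs (hgen (u s))).neg
    rw [sub_self, neg_zero] at this
    refine this.congr fun t => ?_
    rw [← smul_neg, neg_sub]
  · rw [← neg_smul, Lp_const_smul_le_iff]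
    exact hb.mono fun x hx => (abs_le.1 hx).1
  · rw [Lp_le_const_smul_iff]
    exact hb.mono fun x hx => (abs_le.1 hx).2
  · refine (hSk.add (hS.toIsC0Semigroup.tendsto_comp hc (hgen (Lp.const 1 ν (1 : ℝ))))).congr
      fun h => ?_
    rw [← smul_add]
    congr 1
    abel

end Mild

/-! ### Propagation of positivity, mass and two-sided bounds -/

section Mild

variable {Ω : Type*} [MeasurableSpace Ω] {ν : Measure Ω}

theorem hasDerivAt_mul_exp (a b t : ℝ) :
    HasDerivAt (fun t => a * Real.exp (b * t)) (b * (a * Real.exp (b * t))) t := by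
  have h : HasDerivAt (fun t => b * t) b t := by simpa using (hasDerivAt_id t).const_mul b
  exact (h.exp.const_mul a).congr_deriv (by ring)

/-- A mild solution starting from a probability density stays one, and two-sided bounds on the
initial density propagate. -/
theorem IsMildSolution.bounds [IsFiniteMeasure ν]
    {S A : ℝ → Lp ℝ 1 ν →L[ℝ] Lp ℝ 1 ν} {T : ℝ} {u : ℝ → Lp ℝ 1 ν}
    (hu : IsMildSolution ν S A T u) (hS : IsAdjointMarkovSemigroup ν S)
    (hA : ∀ t ∈ Icc 0 T, IsBoundedAdjointMarkovGenerator ν (A t))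
    (hAcont : ContinuousOn A (Icc 0 T)) (hAinf : UniformlyBoundedOnLinfty ν T A)
    {k : Lp ℝ 1 ν} (hk : MemLp k ∞ ν)
    (hSk : Tendsto (fun h : ℝ => h⁻¹ • (S h (Lp.const 1 ν (1 : ℝ)) - Lp.const 1 ν (1 : ℝ)))
      (𝓝[>] 0) (𝓝 k)) (h0 : IsProbDensity ν (u 0)) :
    (∀ t ∈ Icc 0 T, IsProbDensity ν (u t)) ∧
    ∀ C, 0 ≤ C → (∀ᵐ x ∂ν, Real.exp (-C) ≤ u 0 x ∧ u 0 x ≤ Real.exp C) →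
      ∃ C', ∀ t ∈ Icc 0 T, ∀ᵐ x ∂ν, Real.exp (-C') ≤ u t x ∧ u t x ≤ Real.exp C' := by
  obtain ⟨κ, hstep⟩ := hu.exists_markov_step hS hA hAcont hAinf hk hSk
  have hpos : ∀ t ∈ Icc 0 T, 0 ≤ u t := by
    intro t ht
    -- The zero barrier gives positivity.
    have := const_le_of_step hu.1 (φ := fun _ => 0)
      (fun t => by simpa using hasDerivAt_const t (0 : ℝ)) hstep (by simpa using h0.1) t ht
    simpa using this
  have hmass : ∀ t ∈ Icc 0 T, ∫ x, u t x ∂ν = 1 := fun t ht =>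
    (integral_eq_of_step hu.1 (fun s hs => by
      obtain ⟨V, h1, h2, -⟩ := hstep s hs
      exact ⟨V, h1, h2⟩) t ht).trans h0.2
  -- The barriers are `exp (-C - κ t)` and `exp (C + κ t)`; `|κ|` appears because the sign of `κ` is
  -- not recorded.
  refine ⟨fun t ht => ⟨hpos t ht, hmass t ht⟩, fun C hC hC0 => ⟨C + |κ| * T, fun t ht => ?_⟩⟩
  have hκt : |κ * t| ≤ |κ| * T := by
    rw [abs_mul, abs_of_nonneg ht.1]
    exact mul_le_mul_of_nonneg_left ht.2 (abs_nonneg κ)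
  have hlow := const_le_of_step hu.1 (φ := fun t => Real.exp (-C) * Real.exp (-κ * t))
    (fun t => by
      convert hasDerivAt_mul_exp (Real.exp (-C)) (-κ) t using 1
      rw [abs_of_pos (by positivity)]; ring) hstep
    (Lp_const_smul_le_iff.2 (hC0.mono fun x hx => by simpa using hx.1)) t ht
  -- By linearity `-u` obeys the same steps, so the upper bound on `u` is a lower bound on `-u` with
  -- a negative barrier.
  have hstep' : ∀ s ∈ Ico 0 T,
      ∃ V : ℝ → Lp ℝ 1 ν →L[ℝ] Lp ℝ 1 ν, (∀ h, 0 < h → IsMarkovOp ν (V h)) ∧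
      Tendsto (fun t => (t - s)⁻¹ • ((-u) t - V (t - s) ((-u) s))) (𝓝[>] s) (𝓝 0) ∧
      ∃ k : Lp ℝ 1 ν, -(κ • Lp.const 1 ν (1 : ℝ)) ≤ k ∧ k ≤ κ • Lp.const 1 ν (1 : ℝ) ∧
        Tendsto (fun h : ℝ => h⁻¹ • (V h (Lp.const 1 ν (1 : ℝ)) - Lp.const 1 ν (1 : ℝ)))
          (𝓝[>] 0) (𝓝 k) := by
    intro s hs
    obtain ⟨V, h1, h2, h3⟩ := hstep s hs
    refine ⟨V, h1, ?_, h3⟩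
    have := h2.neg
    rw [neg_zero] at this
    refine this.congr fun t => ?_
    rw [Pi.neg_apply, Pi.neg_apply, map_neg, ← smul_neg, neg_sub, neg_sub_neg]
  have hup := const_le_of_step hu.1.neg (φ := fun t => -Real.exp C * Real.exp (κ * t))
    (fun t => by
      convert hasDerivAt_mul_exp (-Real.exp C) κ t using 1
      rw [neg_mul, abs_neg, abs_of_pos (by positivity)]; ring) hstep'
    (by
      rw [Lp_const_smul_le_iff, Pi.neg_apply]
      filter_upwards [hC0, Lp.coeFn_neg (u 0)] with x hx h1
      rw [h1, Pi.neg_apply]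
      simpa using hx.2) t ht
  rw [Lp_const_smul_le_iff] at hlow hup
  filter_upwards [hlow, hup, Lp.coeFn_neg (u t)] with x h1 h2 h3
  rw [Pi.neg_apply, h3, Pi.neg_apply, neg_mul, neg_le_neg_iff] at h2
  rw [← Real.exp_add] at h1 h2
  constructor
  · refine (Real.exp_le_exp.2 ?_).trans h1
    linarith [le_abs_self (κ * t)]
  · refine h2.trans (Real.exp_le_exp.2 ?_)
    linarith [le_abs_self (κ * t)]

theorem HasBoundedLog.exists_bounds {f : Lp ℝ 1 ν} (hf : HasBoundedLog ν f) :
    ∃ C, 0 ≤ C ∧ ∀ᵐ x ∂ν, Real.exp (-C) ≤ f x ∧ f x ≤ Real.exp C := by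
  obtain ⟨C, hC, h⟩ := exists_ae_abs_le_of_memLp_top hf.2
  refine ⟨C, hC, ?_⟩
  filter_upwards [h, hf.1] with x h1 h2
  rw [abs_le] at h1
  exact ⟨(Real.le_log_iff_exp_le h2).1 h1.1, (Real.log_le_iff_le_exp h2).1 h1.2⟩

/-- Split off `f log g`, with `log g` bounded; where `f = 0` both sides vanish. -/
theorem integrable_relEntropy_of_hasBoundedLog {f g : Lp ℝ 1 ν}
    (hf : Integrable (fun x => f x * Real.log (f x)) ν) (hg : HasBoundedLog ν g) :
    Integrable (fun x => f x * Real.log (f x / g x)) ν := by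
  obtain ⟨C, -, h⟩ := exists_ae_abs_le_of_memLp_top hg.2
  have h1 : Integrable (fun x => Real.log (g x) * f x) ν :=
    (L1.integrable_coeFn f).bdd_mul hg.2.1 h
  refine (hf.sub h1).congr ?_
  filter_upwards [hg.1] with x hx
  rcases eq_or_ne (f x) 0 with h0 | h0
  · simp [h0]
  · simp only [Pi.sub_apply]
    rw [Real.log_div h0 hx.ne']
    ring

end Mild

/-! ### The entropy inequality for mild solutions -/

theorem proposition4p1 {Ω : Type*} [MeasurableSpace Ω] (ν : Measure Ω) [IsFiniteMeasure ν]
    (T : ℝ) (hT : 0 < T)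
    -- the adjoint Markov generator `K` and its semigroup `S t = e^{tK}`
    (K : Lp ℝ 1 ν →ₗ.[ℝ] Lp ℝ 1 ν) (S : ℝ → Lp ℝ 1 ν →L[ℝ] Lp ℝ 1 ν)
    (hS : IsAdjointMarkovSemigroup ν S) (hK : infinitesimalGenerator S = K)
    -- the bounded adjoint Markov generators `A t`, `B t`
    (A B : ℝ → Lp ℝ 1 ν →L[ℝ] Lp ℝ 1 ν)
    (hA : ∀ t ∈ Icc 0 T, IsBoundedAdjointMarkovGenerator ν (A t))
    (hB : ∀ t ∈ Icc 0 T, IsBoundedAdjointMarkovGenerator ν (B t))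
    -- `1 ∈ D(K)` and `K 1 ∈ L^∞`
    (hK1 : ∃ h : Lp.const 1 ν (1 : ℝ) ∈ K.domain, MemLp (K ⟨Lp.const 1 ν (1 : ℝ), h⟩) ∞ ν)
    -- norm continuity in time (hence uniform boundedness) on `L¹`
    (hAcont : ContinuousOn A (Icc 0 T)) (hBcont : ContinuousOn B (Icc 0 T))
    -- uniform boundedness on `L^∞`
    (hAinf : UniformlyBoundedOnLinfty ν T A) (hBinf : UniformlyBoundedOnLinfty ν T B)
    -- mild solutions starting from probability densities
    (ρ σ : ℝ → Lp ℝ 1 ν)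
    (hρ : IsMildSolution ν S A T ρ) (hσ : IsMildSolution ν S B T σ)
    (hρ0 : IsProbDensity ν (ρ 0)) (hσ0 : IsProbDensity ν (σ 0))
    (hρlog : Integrable (fun x => ρ 0 x * Real.log (ρ 0 x)) ν)
    (hσlog : HasBoundedLog ν (σ 0)) :
    -- the relative entropies are well defined and finite
    (∀ s ∈ Icc 0 T, IsProbDensity ν (ρ s) ∧ IsProbDensity ν (σ s) ∧ (∀ᵐ x ∂ν, 0 < σ s x) ∧
      Integrable (fun x => ρ s x * Real.log (ρ s x / σ s x)) ν) ∧
    ∀ t ∈ Icc 0 T, ∀ η : ℝ, 0 < η →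
      -- the integrals on the right-hand side are well defined and finite
      (∀ s ∈ Icc 0 t, Integrable (expPerturbation ν (A s - B s) η (σ s)) ν) ∧
      IntervalIntegrable (fun s => relEntropy ν (ρ s) (σ s) +
        Real.log (∫ x, expPerturbation ν (A s - B s) η (σ s) x ∂ν)) volume 0 t ∧
      relEntropy ν (ρ t) (σ t) ≤ relEntropy ν (ρ 0) (σ 0) +
        η * ∫ s in (0 : ℝ)..t, (relEntropy ν (ρ s) (σ s) +
          Real.log (∫ x, expPerturbation ν (A s - B s) η (σ s) x ∂ν)) := by
  obtain ⟨h1, hk⟩ := hK1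
  have hSk : Tendsto (fun h : ℝ => h⁻¹ • (S h (Lp.const 1 ν (1 : ℝ)) - Lp.const 1 ν (1 : ℝ)))
      (𝓝[>] 0) (𝓝 (K ⟨Lp.const 1 ν (1 : ℝ), h1⟩)) := by
    subst hK
    exact infinitesimalGenerator_spec S ⟨_, h1⟩
  have hρb := hρ.bounds hS hA hAcont hAinf hk hSk hρ0
  have hσb := hσ.bounds hS hB hBcont hBinf hk hSk hσ0
  obtain ⟨C₀, hC₀, hσ0b⟩ := hσlog.exists_bounds
  obtain ⟨C, hC⟩ := hσb.2 C₀ hC₀ hσ0b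
  obtain ⟨C₁, hC₁, hA'⟩ := hAinf.exists_ae_abs_le
  obtain ⟨C₂, hC₂, hB'⟩ := hBinf.exists_ae_abs_le
  -- The lower bound `exp (-C)` for `σ` gives `c`; the upper bound `exp C` and the `L^∞` bounds of
  -- `A` and `B` give the drift bound.
  have H : IsEntropyFlow ν T (Real.exp (-C)) (C₁ * Real.exp C + C₂ * Real.exp C) ρ σ
      (fun t => (A t - B t) (σ t)) := by
    refine ⟨Real.exp_pos _, by positivity, hρ.1, hσ.1, (hAcont.sub hBcont).clm_apply hσ.1,
      fun t ht => (Lp.coeFn_nonneg _).2 (hρb.1 t ht).1, fun t ht => (hC t ht).mono fun x hx => hx.1,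
      fun t ht => ?_, fun t ht => (hρb.1 t ht).2, fun t ht => (hσb.1 t ht).2, fun s hs => ?_⟩
    · have hσt : ∀ᵐ x ∂ν, |σ t x| ≤ Real.exp C := (hC t ht).mono fun x hx => by
        rw [abs_of_pos ((Real.exp_pos _).trans_le hx.1)]
        exact hx.2
      filter_upwards [hA' t ht (σ t) _ (Real.exp_pos C).le hσt,
        hB' t ht (σ t) _ (Real.exp_pos C).le hσt, Lp.coeFn_sub (A t (σ t)) (B t (σ t))]
        with x h1 h2 h3
      rw [_root_.sub_apply, h3, Pi.sub_apply]
      exact (abs_sub _ _).trans (add_le_add h1 h2)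
    -- Both curves are compared with the semigroup of `A s`, so the first has no drift and the
    -- second has drift `(A s - B s) (σ s)`.
    · obtain ⟨M, hM, hgen⟩ := (hA s ⟨hs.1, hs.2.le⟩).exists_semigroup
      refine ⟨fun h => (S h).comp (M h),
        fun h hh => (hS.isMarkovOp hh.le).comp (hM.isMarkovOp hh.le), ?_,
        hσ.tendsto_step hS hBcont hs (hgen (σ s))⟩
      have := (hρ.tendsto_step hS hAcont hs (hgen (ρ s))).neg
      rw [sub_self, neg_zero] at this
      refine this.congr fun t => ?_
      rw [← smul_neg, neg_sub]
  have hi := integrable_relEntropy_of_hasBoundedLog hρlog hσlog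
  refine ⟨fun s hs => ⟨hρb.1 s hs, hσb.1 s hs, H.snd_pos hs, H.integrable_entropy hi hs⟩,
    fun t ht η hη => ⟨fun s hs => H.integrable_exp_drift hη ⟨hs.1, hs.2.trans ht.2⟩,
      H.relEntropy_le_exp hi hη ht⟩⟩
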